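/- Let $q>1$, let $\chi$ be a primitive Dirichlet character modulo $q$, let $u$ be a real number and let $s_0\in\mathbb C$ be arbitrary. Notation. Put $\kappa=0$ if $\chi(-1)=1$ and $\kappa=1$ if $\chi(-1)=-1$, $\;\epsilon(\chi)=\frac{1}{i^{\kappa}\sqrt q}\sum_{n=1}^{q}\chi(n)e^{2\pi i n/q}$, $\;g(s,\chi)=\left(\frac q\pi\right)^{\frac{s+\kappa}{2}}\Gamma\!\left(\frac{s+\kappa}{2}\right)$, let $\xi(s,\chi)$ be the entire function $g(s,\chi)L(s,\chi)$ (removable singularities removed), and let $$L_u(s,\chi)=\prod_{p\le u}\frac{1}{1-\chi(p)p^{-s}},\qquad \xi_u(s,\chi)=g(s,\chi)L_u(s,\chi),$$ the product being over primes. For a prime $p\le u$ let $\xi_u^{\setminus\{p\}}(s,\chi)$ be $\xi_u(s,\chi)$ with the Euler factor at $p$ omitted. For a prime $p\nmid q$ and $h\in\mathbb Z$ let $\rho_{p,h}=\frac{i}{\log p}\left(\arg\chi(p)+2\pi h\right)$; these are the solutions of $p^{\rho}=\chi(p)$. The principal part of $\xi_u$ is $$\xi_u^{pp}(s,\chi)=\sum_{\substack{p\le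 u\\ p\nmid q}}\ \sum_{\substack{h\in\mathbb Z\\ \rho_{p,h}\ne0}}\frac{\xi_u^{\setminus\{p\}}(\rho_{p,h},\chi)}{(s-\rho_{p,h})\log p}+\sum_{\substack{h\ge 0\\ 2h+\kappa\neq0}}\frac{2(-1)^h\pi^hL_u(-2h-\kappa,\chi)}{q^h\,h!\,(s+2h+\kappa)}+P_0(s),$$ where $P_0$ is the principal part of the Laurent expansion of $\xi_u(\cdot,\chi)$ at $0$, and where the first double sum is understood as the limit of its partial sums over $|\rho_{p,h}|<T$ as $T\to\infty$ through radii that keep a fixed positive distance (any such distance) from all the numbers $|\rho_{p,h}|$, $p\le u$, $p\nmid q$ (whenever the double series itself converges absolutely, this limit is its sum). Claim. The limit that defines $\xi_u^{pp}(s,\chi)$ exists for every $s$ that is not one of the $\rho_{p,h}$, and $\xi_u(s,\chi)-\xi_u^{pp}(s,\chi)$ extends to an entire function $\xi_u^{reg}(s,\chi)$. With $$\xi_u^{\approx}(s,\chi)=\xi_u^{reg}(s,\chi)+\epsilon(\chi)\,\xi_u^{reg}(1-s,\overline\chi)$$ and $A_u$ the set of positive integers that have at least one prime factor greater than $u$,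 one has $$\xi(s_0,\chi)-\xi_u^{\approx}(s_0,\chi)=\sum_{n\in A_u}J(n),$$ the series being absolutely convergent, where $$J(n)=\chi(n)n^{\kappa}\left(\frac{q}{n^2\pi}\right)^{\frac{\kappa+s_0}{2}}\Gamma\!\left(\frac{\kappa+s_0}{2},\frac{n^2\pi}{q}\right)+\epsilon(\chi)\overline{\chi}(n)n^{\kappa}\left(\frac{q}{n^2\pi}\right)^{\frac{\kappa+1-s_0}{2}}\Gamma\!\left(\frac{\kappa+1-s_0}{2},\frac{n^2\pi}{q}\right)$$ and $\Gamma(z,x)=\int_x^\infty e^{-t}t^{z-1}\,dt$ for $x>0$, $z\in\mathbb C$. -/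

import Mathlib

open Complex Filter Topology

noncomputable section

namespace DirichletApprox

/-- `κ(χ)`: `0` if `χ(-1) = 1`, and `1` otherwise (that is, if `χ(-1) = -1`). -/
def kappa {q : ℕ} (χ : DirichletCharacter ℂ q) : ℕ :=
  open Classical in if χ (-1) = 1 then 0 else 1

/-- `g(s, χ) = (q / π) ^ ((s + κ) / 2) * Γ((s + κ) / 2)`. -/
def g {q : ℕ} (χ : DirichletCharacter ℂ q) (s : ℂ) : ℂ :=
  ((q / Real.pi : ℝ) : ℂ) ^ ((s + kappa χ) / 2) * Gamma ((s + kappa χ) / 2)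

/-- `ε(χ) = τ(χ) / (i ^ κ * √q)`, where `τ(χ) = ∑ a mod q, χ(a) * exp(2 π i a / q)`. -/
def epsilon {q : ℕ} [NeZero q] (χ : DirichletCharacter ℂ q) : ℂ :=
  (∑ a : ZMod q, χ a * exp (2 * Real.pi * I * a.val / q)) /
    (I ^ kappa χ * (Real.sqrt q : ℂ))

/-- The completed `L`-function `ξ(s, χ) = g(s, χ) * L(s, χ)`. Mathlib's `completedLFunction` is the
continuation of `π ^ (-(s + κ) / 2) * Γ((s + κ) / 2) * L(s, χ)` across the poles of the Gamma
factor, but without the power of `q`; see `xi_eq` and `differentiable_xi`. -/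
def xi {q : ℕ} [NeZero q] (χ : DirichletCharacter ℂ q) (s : ℂ) : ℂ :=
  (q : ℂ) ^ ((s + kappa χ) / 2) * DirichletCharacter.completedLFunction χ s

theorem xi_eq {q : ℕ} [NeZero q] (hq : q ≠ 1) (χ : DirichletCharacter ℂ q) (s : ℂ)
    (hs : ∀ m : ℕ, (s + kappa χ) / 2 ≠ -m) :
    xi χ s = g χ s * DirichletCharacter.LFunction χ s := by
  have hq0 : (0 : ℝ) ≤ q := Nat.cast_nonneg q
  have hpi : (Real.pi : ℂ) ≠ 0 := by exact_mod_cast Real.pi_ne_zero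
  have hG : Gamma ((s + kappa χ) / 2) ≠ 0 := Gamma_ne_zero hs
  have hpc : (Real.pi : ℂ) ^ ((s + kappa χ) / 2) ≠ 0 := by simp [cpow_eq_zero_iff, hpi]
  have hg : DirichletCharacter.gammaFactor χ s =
      (Real.pi : ℂ) ^ (-(s + kappa χ) / 2) * Gamma ((s + kappa χ) / 2) := by
    rcases χ.even_or_odd with h | h
    · have hk : kappa χ = 0 := if_pos h
      rw [h.gammaFactor_def, hk, Gammaℝ_def]
      simp
    · have hk : kappa χ = 1 := if_neg h.not_even
      rw [h.gammaFactor_def, hk, Gammaℝ_def]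
      simp
  rw [DirichletCharacter.LFunction_eq_completed_div_gammaFactor χ s (Or.inr hq), hg, xi, g,
    ofReal_div, Complex.div_cpow_ofReal_nonneg hq0 Real.pi_nonneg, neg_div, cpow_neg]
  push_cast
  field_simp

theorem differentiable_xi {q : ℕ} [NeZero q] (χ : DirichletCharacter ℂ q) (hχ : χ ≠ 1) :
    Differentiable ℂ (xi χ) := by
  have h := DirichletCharacter.differentiable_completedLFunction hχ
  have hq : (q : ℂ) ≠ 0 := NeZero.ne _
  exact (Differentiable.const_cpow (by fun_prop) (Or.inl hq)).mul h

/-- The primes `p ≤ u`. -/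
def primesUpTo (u : ℝ) : Finset ℕ :=
  (Finset.range (⌊u⌋₊ + 1)).filter Nat.Prime

/-- The truncated Euler product `L_u(s, χ)`. -/
def LU {q : ℕ} (χ : DirichletCharacter ℂ q) (u : ℝ) (s : ℂ) : ℂ :=
  ∏ p ∈ primesUpTo u, 1 / (1 - χ (p : ZMod q) / (p : ℂ) ^ s)

/-- `ξ_u(s, χ) = g(s, χ) * L_u(s, χ)`. -/
def xiU {q : ℕ} (χ : DirichletCharacter ℂ q) (u : ℝ) (s : ℂ) : ℂ :=
  g χ s * LU χ u s

/-- `ξ_u(s, χ)` with the Euler factor at `p` removed. -/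
def xiUErase {q : ℕ} (χ : DirichletCharacter ℂ q) (u : ℝ) (p : ℕ) (s : ℂ) : ℂ :=
  g χ s * ∏ r ∈ (primesUpTo u).erase p, 1 / (1 - χ (r : ZMod q) / (r : ℂ) ^ s)

/-- The primes `p ≤ u` with `p ∤ q`: those whose Euler factor has poles. -/
def goodPrimes (q : ℕ) (u : ℝ) : Finset ℕ :=
  (primesUpTo u).filter fun p => ¬ p ∣ q

/-- The poles of the Euler factor at `p ∤ q`, that is, the solutions `ρ` of `p ^ ρ = χ(p)`, indexed
by `h : ℤ`: `ρ = i * (arg χ(p) + 2 π h) / log p`. -/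
def eulerPole {q : ℕ} (χ : DirichletCharacter ℂ q) (p : ℕ) (h : ℤ) : ℂ :=
  (((arg (χ (p : ZMod q)) + 2 * Real.pi * h) / Real.log p : ℝ) : ℂ) * I

/-- The principal part of `ξ_u` at the pole `eulerPole χ p h`, left out (`0`) if this is the
point `0`. -/
def eulerTerm {q : ℕ} (χ : DirichletCharacter ℂ q) (u : ℝ) (p : ℕ) (s : ℂ) (h : ℤ) : ℂ :=
  open Classical in
  if eulerPole χ p h = 0 then 0
  else xiUErase χ u p (eulerPole χ p h) / ((s - eulerPole χ p h) * (Real.log p : ℂ))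

/-- The sum of the principal parts of `ξ_u` at the poles `ρ ≠ 0` with `|ρ| < T` that come from the
Euler factors (a finite sum). -/
def eulerPartTrunc {q : ℕ} (χ : DirichletCharacter ℂ q) (u T : ℝ) (s : ℂ) : ℂ :=
  ∑ p ∈ goodPrimes q u, ∑ᶠ (h : ℤ) (_ : ‖eulerPole χ p h‖ < T), eulerTerm χ u p s h

/-- `T → ∞` through radii that keep a positive distance from the moduli of all Euler poles. -/
def separatedRadii {q : ℕ} (χ : DirichletCharacter ℂ q) (u : ℝ) : Filter ℝ :=
  ⨆ (δ : ℝ) (_ : 0 < δ),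
    atTop ⊓ 𝓟 {T : ℝ | ∀ p ∈ goodPrimes q u, ∀ h : ℤ, δ ≤ |T - ‖eulerPole χ p h‖|}

/-- The sum of the principal parts of `ξ_u` at all poles `ρ ≠ 0` that come from the Euler factors,
taken as the limit of the sums over `|ρ| < T` as `T → ∞` through separated radii. By
`eulerPart_eq_tsum` it is the plain double series whenever that series converges. -/
def eulerPart {q : ℕ} (χ : DirichletCharacter ℂ q) (u : ℝ) (s : ℂ) : ℂ :=
  limUnder (separatedRadii χ u) fun T => eulerPartTrunc χ u T s

theorem norm_eulerPole {q : ℕ} (χ : DirichletCharacter ℂ q) (p : ℕ) (h : ℤ) :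
    ‖eulerPole χ p h‖ = |(arg (χ (p : ZMod q)) + 2 * Real.pi * h) / Real.log p| := by
  rw [eulerPole, norm_mul, norm_I, mul_one, norm_real, Real.norm_eq_abs]

theorem finite_eulerPole_lt {q : ℕ} (χ : DirichletCharacter ℂ q) {p : ℕ} (hp : p.Prime) (T : ℝ) :
    {h : ℤ | ‖eulerPole χ p h‖ < T}.Finite := by
  have hlog : 0 < Real.log p := Real.log_pos (by exact_mod_cast hp.one_lt)
  have hpi := Real.pi_pos
  set a := arg (χ (p : ZMod q))
  refine (Set.finite_Icc ⌊(-(T * Real.log p) - a) / (2 * Real.pi)⌋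
    ⌈(T * Real.log p - a) / (2 * Real.pi)⌉).subset fun h hh => ?_
  rw [Set.mem_ofPred_eq, norm_eulerPole, abs_div, abs_of_pos hlog, div_lt_iff₀ hlog, abs_lt] at hh
  constructor
  · have h2 : (⌊(-(T * Real.log p) - a) / (2 * Real.pi)⌋ : ℝ) ≤ h :=
      (Int.floor_le _).trans (by rw [div_le_iff₀ (by positivity)]; linarith [hh.1])
    exact_mod_cast h2
  · have h2 : (h : ℝ) ≤ ⌈(T * Real.log p - a) / (2 * Real.pi)⌉ :=
      le_trans (by rw [le_div_iff₀ (by positivity)]; linarith [hh.2]) (Int.le_ceil _)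
    exact_mod_cast h2

theorem separatedRadii_le_atTop {q : ℕ} (χ : DirichletCharacter ℂ q) (u : ℝ) :
    separatedRadii χ u ≤ atTop :=
  iSup₂_le fun _ _ => inf_le_left

/-- Avoiding an arithmetic progression on a subinterval. -/
theorem exists_subinterval (c d η : ℝ) (hd : 0 < d) (hη : 0 < η) :
    ∃ η' : ℝ, 0 < η' ∧ ∀ a : ℝ, ∃ a' : ℝ, a ≤ a' ∧ a' + η' ≤ a + η ∧
      ∀ T ∈ Set.Icc a' (a' + η'), ∀ h : ℤ, η' ≤ |T - (c + d * h)| := by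
  have hm : 0 < min η d := lt_min hη hd
  have h1 := min_le_left η d
  have h2 := min_le_right η d
  refine ⟨min η d / 6, by positivity, fun a => ?_⟩
  set e := min η d / 6 with he
  have he0 : 0 < e := by positivity
  by_cases H : ∀ T ∈ Set.Icc a (a + e), ∀ h : ℤ, e ≤ |T - (c + d * h)|
  · exact ⟨a, le_rfl, by linarith, H⟩
  · push Not at H
    obtain ⟨T₁, ⟨hT1, hT2⟩, h₁, hh⟩ := H
    rw [abs_lt] at hh
    refine ⟨a + 3 * e, by linarith, by linarith, fun T ⟨hT3, hT4⟩ h => ?_⟩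
    rw [le_abs]
    rcases le_or_gt h h₁ with hle | hgt
    · left
      have : d * h ≤ d * h₁ := mul_le_mul_of_nonneg_left (by exact_mod_cast hle) hd.le
      linarith [hh.1, hh.2]
    · right
      have : d * (h₁ + 1) ≤ d * h :=
        mul_le_mul_of_nonneg_left (by exact_mod_cast hgt) hd.le
      linarith [hh.1, hh.2]

theorem separatedRadii_neBot {q : ℕ} (χ : DirichletCharacter ℂ q) (u : ℝ) :
    (separatedRadii χ u).NeBot := by
  have key : ∀ S : Finset ℕ, (∀ p ∈ S, p.Prime) → ∃ η : ℝ, 0 < η ∧ ∀ R : ℝ, ∃ a : ℝ, R ≤ a ∧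
      ∀ T ∈ Set.Icc a (a + η), 0 ≤ R → ∀ p ∈ S, ∀ h : ℤ, η ≤ |T - ‖eulerPole χ p h‖| := by
    intro S
    induction S using Finset.induction_on with
    | empty => exact fun _ => ⟨1, one_pos, fun R => ⟨R, le_rfl, by simp⟩⟩
    | insert p S hp ih =>
      intro hS
      obtain ⟨η, hη, H⟩ := ih fun r hr => hS r (Finset.mem_insert_of_mem hr)
      have hlog : 0 < Real.log p :=
        Real.log_pos (by exact_mod_cast (hS p (Finset.mem_insert_self p S)).one_lt)
      have hd : 0 < 2 * Real.pi / Real.log p := by positivity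
      set a₀ := arg (χ (p : ZMod q)) / Real.log p with ha₀
      obtain ⟨η₁, hη₁, H₁⟩ := exists_subinterval a₀ _ η hd hη
      obtain ⟨η₂, hη₂, H₂⟩ := exists_subinterval (-a₀) _ η₁ hd hη₁
      refine ⟨η₂, hη₂, fun R => ?_⟩
      obtain ⟨a, haR, ha⟩ := H R
      obtain ⟨b, hab, hb, hb'⟩ := H₁ a
      obtain ⟨c, hbc, hc, hc'⟩ := H₂ b
      have h12 : η₂ ≤ η₁ := by linarith
      have h1 : η₁ ≤ η := by linarith
      refine ⟨c, by linarith, fun T hT hR r hr h => ?_⟩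
      have hTb : T ∈ Set.Icc b (b + η₁) := ⟨by linarith [hT.1], by linarith [hT.2]⟩
      rcases Finset.mem_insert.1 hr with rfl | hr
      · rw [norm_eulerPole]
        have e1 := hb' T hTb h
        have e2 := hc' T hT (-h)
        have e : (arg (χ (r : ZMod q)) + 2 * Real.pi * h) / Real.log r =
            a₀ + 2 * Real.pi / Real.log r * h := by rw [ha₀]; ring
        rw [e]
        rcases abs_cases (a₀ + 2 * Real.pi / Real.log r * h) with ⟨h', -⟩ | ⟨h', -⟩ <;> rw [h']
        · linarith
        · convert e2 using 3
          push_cast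
          ring
      · exact (h12.trans h1).trans
          (ha T ⟨by linarith [hTb.1], by linarith [hTb.2]⟩ hR r hr h)
  obtain ⟨η, hη, H⟩ := key (goodPrimes q u) fun p hp =>
    (Finset.mem_filter.1 (Finset.mem_filter.1 hp).1).2
  have hle : atTop ⊓ 𝓟 {T : ℝ | ∀ p ∈ goodPrimes q u, ∀ h : ℤ, η ≤ |T - ‖eulerPole χ p h‖|} ≤
      separatedRadii χ u :=
    le_iSup₂_of_le (f := fun (δ : ℝ) (_ : 0 < δ) => atTop ⊓
      𝓟 {T : ℝ | ∀ p ∈ goodPrimes q u, ∀ h : ℤ, δ ≤ |T - ‖eulerPole χ p h‖|}) η hη le_rfl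
  refine NeBot.mono ?_ hle
  rw [← frequently_mem_iff_neBot, frequently_atTop]
  intro R
  obtain ⟨a, ha, h⟩ := H (max R 0)
  exact ⟨a, (le_max_left _ _).trans ha, h a ⟨le_rfl, by linarith⟩ (le_max_right _ _)⟩

/-- Where the double series over all Euler poles converges, `eulerPart` is its sum. -/
theorem eulerPart_eq_tsum {q : ℕ} (χ : DirichletCharacter ℂ q) (u : ℝ) (s : ℂ)
    (hs : ∀ p ∈ goodPrimes q u, Summable (eulerTerm χ u p s)) :
    eulerPart χ u s = ∑ p ∈ goodPrimes q u, ∑' h : ℤ, eulerTerm χ u p s h := by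
  have := separatedRadii_neBot χ u
  refine Tendsto.limUnder_eq (Tendsto.mono_left ?_ (separatedRadii_le_atTop χ u))
  refine tendsto_finsetSum _ fun p hp => ?_
  have hpp : p.Prime := (Finset.mem_filter.1 (Finset.mem_filter.1 hp).1).2
  have hfin := finite_eulerPole_lt χ hpp
  have e : (fun T : ℝ => ∑ᶠ (h : ℤ) (_ : ‖eulerPole χ p h‖ < T), eulerTerm χ u p s h) =
      fun T => ∑ h ∈ (hfin T).toFinset, eulerTerm χ u p s h := by
    funext T
    exact finsum_mem_eq_finite_toFinset_sum _ (hfin T)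
  rw [e]
  refine (hs p hp).hasSum.comp (tendsto_atTop_finset_of_monotone ?_ ?_)
  · intro T T' hT h hh
    simp only [Set.Finite.mem_toFinset, Set.mem_ofPred_eq] at hh ⊢
    exact hh.trans_le hT
  · intro h
    exact ⟨‖eulerPole χ p h‖ + 1, by simp⟩

/-- The principal parts of `ξ_u` at the poles `-2h - κ ≠ 0` of the Gamma factor. -/
def gammaPart {q : ℕ} (χ : DirichletCharacter ℂ q) (u : ℝ) (s : ℂ) : ℂ :=
  ∑' h : ℕ, if 2 * h + kappa χ = 0 then 0 else
    2 * (-1) ^ h * (Real.pi : ℂ) ^ h * LU χ u (-2 * h - kappa χ) /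
      ((q : ℂ) ^ h * Gamma (h + 1) * (s + 2 * h + kappa χ))

/-- The coefficient of `z ^ (-(k + 1))` in the Laurent expansion of `f` at `0`: the integral
is constant in `r` for all small `r > 0`. -/
def polarCoeff (f : ℂ → ℂ) (k : ℕ) : ℂ :=
  limUnder (𝓝[>] (0 : ℝ)) fun r => (2 * Real.pi * I)⁻¹ * ∮ z in C(0, r), z ^ k * f z

/-- The principal part of the Laurent expansion of `f` at `0`. -/
def principalPartAtZero (f : ℂ → ℂ) (s : ℂ) : ℂ :=
  ∑' k : ℕ, polarCoeff f k / s ^ (k + 1)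

/-- The principal part `ξ_u^pp(s, χ)` of `ξ_u(s, χ)`. -/
def xiPP {q : ℕ} (χ : DirichletCharacter ℂ q) (u : ℝ) (s : ℂ) : ℂ :=
  eulerPart χ u s + gammaPart χ u s + principalPartAtZero (xiU χ u) s

/-- The regular part `ξ_u^reg = ξ_u - ξ_u^pp`, with its removable singularities removed. -/
def xiReg {q : ℕ} (χ : DirichletCharacter ℂ q) (u : ℝ) (s : ℂ) : ℂ :=
  limUnder (𝓝[≠] s) fun z => xiU χ u z - xiPP χ u z

/-- `ξ_u^≈(s, χ) = ξ_u^reg(s, χ) + ε(χ) * ξ_u^reg(1 - s, χ̄)`; here `χ⁻¹` is `χ̄`. -/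
def xiApprox {q : ℕ} [NeZero q] (χ : DirichletCharacter ℂ q) (u : ℝ) (s : ℂ) : ℂ :=
  xiReg χ u s + epsilon χ * xiReg χ⁻¹ u (1 - s)

/-- The upper incomplete Gamma function `Γ(z, x)`, for `x > 0`. -/
def incGamma (z : ℂ) (x : ℝ) : ℂ :=
  ∫ t in Set.Ioi x, (Real.exp (-t) : ℂ) * (t : ℂ) ^ (z - 1)

/-- `A_u`: the positive integers with at least one prime factor greater than `u`. -/
def A (u : ℝ) : Set ℕ :=
  {n | 0 < n ∧ ∃ p : ℕ, p.Prime ∧ p ∣ n ∧ u < p}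

/-- The summand `J(n)`. -/
def J {q : ℕ} [NeZero q] (χ : DirichletCharacter ℂ q) (s₀ : ℂ) (n : ℕ) : ℂ :=
  χ (n : ZMod q) * (n : ℂ) ^ kappa χ *
      ((q / (n ^ 2 * Real.pi) : ℝ) : ℂ) ^ ((kappa χ + s₀) / 2) *
      incGamma ((kappa χ + s₀) / 2) (n ^ 2 * Real.pi / q) +
    epsilon χ * (starRingEnd ℂ) (χ (n : ZMod q)) * (n : ℂ) ^ kappa χ *
      ((q / (n ^ 2 * Real.pi) : ℝ) : ℂ) ^ ((kappa χ + 1 - s₀) / 2) *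
      incGamma ((kappa χ + 1 - s₀) / 2) (n ^ 2 * Real.pi / q)

end DirichletApprox

end

/-! For `re s > 1` the completed series `ξ` is the Mellin transform at `(s + κ) / 2` of the theta
series `∑ χ(n) n ^ κ exp (-π n² x / q)`, and `ξ_u` is the transform of its subseries over the
integers whose prime factors are all at most `u`. Split both integrals at `x = 1`. The parts over `x
> 1`, called `fullTail` and `smoothTail`, are entire.

The heart of the proof is that the regular part of `ξ_u` is exactly `smoothTail` (`xiReg_eq`). The
difference `ξ_u - smoothTail` is `O(1 / |s|)` away from the poles
(`exists_xiU_sub_smoothTail_bound`). For `re s ≥ 2` it is a sum of integrals over `(0, 1)`, and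
integration by parts gives the decay. For `re s ≤ 2` the factor `g` and the tail decay separately,
and `L_u` is bounded. By Cauchy's formula on growing circles (`exists_tendsto_sub_principal_parts`,
`exists_truncation`), such a function is the limit of the sums of its principal parts, and these are
the principal parts of `ξ_u` because the tail is entire.

For `ξ` itself, `ξ(s, χ) = fullTail(s, χ) + ε(χ) fullTail(1 - s, χ̄)` (`xi_eq_fullTail`). This is
Riemann's splitting, obtained here from the functional equation and Liouville's theorem. Subtracting
`ξ_u^≈` leaves the terms of the tails at the integers that have a prime factor greater than `u`. The
substitution `t = (π n² / q) x` turns these terms into `J(n)`. -/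

namespace DirichletApprox

open Set MeasureTheory Asymptotics Metric

/-! ### Mellin integrals of `exp (-a x)`, cut at `x = 1` -/

/-- The Mellin transform of `exp (-a x)`, restricted to `x > 1`. -/
noncomputable def expTail (z : ℂ) (a : ℝ) : ℂ :=
  mellin ((Ioi (1 : ℝ)).indicator fun x => ((Real.exp (-(a * x)) : ℝ) : ℂ)) z

theorem expTail_eq (z : ℂ) (a : ℝ) :
    expTail z a = ∫ x in Ioi (1 : ℝ), (x : ℂ) ^ (z - 1) * ((Real.exp (-(a * x)) : ℝ) : ℂ) := by
  have h : (fun t : ℝ => (t : ℂ) ^ (z - 1) • (Ioi (1 : ℝ)).indicator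
      (fun x => ((Real.exp (-(a * x)) : ℝ) : ℂ)) t) =
      (Ioi (1 : ℝ)).indicator fun x => (x : ℂ) ^ (z - 1) * ((Real.exp (-(a * x)) : ℝ) : ℂ) := by
    funext t
    by_cases ht : t ∈ Ioi (1 : ℝ) <;> simp [ht, Set.indicator]
  rw [expTail, mellin, h, setIntegral_indicator measurableSet_Ioi]
  congr 2
  ext x
  simp only [mem_inter_iff, mem_Ioi]
  exact ⟨fun h => h.2, fun h => ⟨one_pos.trans h, h⟩⟩

/-- These are the hypotheses of the criteria for convergence and holomorphy of a Mellin transform.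
Since the function vanishes near `0`, every exponent `b` is allowed there, so the transform is
entire. -/
theorem expTail_aux {a : ℝ} :
    LocallyIntegrableOn ((Ioi (1 : ℝ)).indicator fun x => ((Real.exp (-(a * x)) : ℝ) : ℂ))
      (Ioi 0) ∧
    ((Ioi (1 : ℝ)).indicator fun x => ((Real.exp (-(a * x)) : ℝ) : ℂ)) =O[atTop]
      (fun t => Real.exp (-a * t)) ∧
    ∀ b : ℝ, ((Ioi (1 : ℝ)).indicator fun x => ((Real.exp (-(a * x)) : ℝ) : ℂ)) =O[𝓝[>] 0]
      (fun x => x ^ (-b)) := by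
  refine ⟨?_, ?_, fun b => ?_⟩
  · have hc : Continuous fun x : ℝ => ((Real.exp (-(a * x)) : ℝ) : ℂ) := by fun_prop
    exact (hc.locallyIntegrable.indicator measurableSet_Ioi).locallyIntegrableOn _
  · refine IsBigO.of_bound 1 (Eventually.of_forall fun x => ?_)
    by_cases hx : x ∈ Ioi (1 : ℝ)
    · rw [indicator_of_mem hx, norm_real, one_mul, neg_mul]
    · rw [indicator_of_notMem hx, norm_zero]
      positivity
  · refine IsBigO.of_bound 1 ?_
    filter_upwards [mem_nhdsWithin_of_mem_nhds (Iio_mem_nhds one_pos), self_mem_nhdsWithin]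
      with x hx hx0
    have h1 : x ∉ Ioi (1 : ℝ) := fun h => lt_asymm (mem_Ioi.1 h) (mem_Iio.1 hx)
    rw [indicator_of_notMem h1, norm_zero]
    positivity

theorem differentiable_expTail {a : ℝ} (ha : 0 < a) : Differentiable ℂ fun z => expTail z a :=
  fun z => mellin_differentiableAt_of_isBigO_rpow_exp (b := z.re - 1) ha expTail_aux.1
    expTail_aux.2.1 (expTail_aux.2.2 _) (by linarith)

theorem integrableOn_expTail {a : ℝ} (ha : 0 < a) (z : ℂ) :
    IntegrableOn (fun x : ℝ => (x : ℂ) ^ (z - 1) * ((Real.exp (-(a * x)) : ℝ) : ℂ))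
      (Ioi 1) := by
  have h : MellinConvergent ((Ioi (1 : ℝ)).indicator fun x => ((Real.exp (-(a * x)) : ℝ) : ℂ)) z :=
    mellinConvergent_of_isBigO_rpow_exp (b := z.re - 1) ha expTail_aux.1
      expTail_aux.2.1 (expTail_aux.2.2 _) (by linarith)
  refine (h.mono_set (Ioi_subset_Ioi zero_le_one)).congr_fun (fun x hx => ?_) measurableSet_Ioi
  simp [indicator_of_mem hx]

theorem integrableOn_rpow_mul_exp_Ioi_one {a : ℝ} (ha : 0 < a) (σ : ℝ) :
    IntegrableOn (fun x : ℝ => x ^ (σ - 1) * Real.exp (-(a * x))) (Ioi 1) := by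
  refine IntegrableOn.congr_fun (Integrable.norm (integrableOn_expTail ha σ)) (fun x hx => ?_)
    measurableSet_Ioi
  have hx0 : (0 : ℝ) < x := one_pos.trans hx
  simp [norm_cpow_eq_rpow_re_of_pos hx0, abs_of_pos, Real.exp_pos, -ofReal_exp]

/-- A bound for `expTail`, uniform in a left half-plane. -/
theorem norm_expTail_le {σ a₀ a : ℝ} (ha₀ : 0 < a₀) (ha : a₀ ≤ a) {z : ℂ} (hz : z.re ≤ σ) :
    ‖expTail z a‖ ≤ Real.exp (-(a / 2)) *
      ∫ x in Ioi (1 : ℝ), x ^ (σ - 1) * Real.exp (-(a₀ / 2 * x)) := by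
  rw [expTail_eq, ← integral_const_mul]
  refine (norm_integral_le_integral_norm _).trans ?_
  refine setIntegral_mono_on (integrableOn_expTail (ha₀.trans_le ha) z).norm
    ((integrableOn_rpow_mul_exp_Ioi_one (half_pos ha₀) σ).const_mul _) measurableSet_Ioi
    fun x hx => ?_
  have hx1 : (1 : ℝ) < x := hx
  have hx0 : (0 : ℝ) < x := one_pos.trans hx
  rw [norm_mul, norm_cpow_eq_rpow_re_of_pos hx0, norm_real, Real.norm_eq_abs,
    abs_of_pos (Real.exp_pos _), mul_left_comm, ← Real.exp_add, sub_re, one_re]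
  -- As `x > 1`, half of the exponent `a * x` pays for `a / 2`, and the other half for `a₀ / 2 * x`.
  refine mul_le_mul (Real.rpow_le_rpow_of_exponent_le hx1.le (by linarith))
    (Real.exp_le_exp.2 ?_) (Real.exp_pos _).le (by positivity)
  nlinarith

/-- Integration by parts. A factor `z` is traded for a shift of the argument by `1`, so a uniform
bound for `expTail` becomes decay like `1 / ‖z‖`. -/
theorem mul_expTail {a : ℝ} (ha : 0 < a) {z : ℂ} (hz : z ≠ 0) :
    z * expTail z a = -((Real.exp (-a) : ℝ) : ℂ) + a * expTail (z + 1) a := by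
  have i1 := (integrableOn_expTail ha z).const_mul z
  have i2 := (integrableOn_expTail ha (z + 1)).const_mul (a : ℂ)
  have hd : ∀ x ∈ Ioi (1 : ℝ), HasDerivAt
      (fun x : ℝ => (x : ℂ) ^ z * ((Real.exp (-(a * x)) : ℝ) : ℂ))
      (z * ((x : ℂ) ^ (z - 1) * ((Real.exp (-(a * x)) : ℝ) : ℂ)) -
        a * ((x : ℂ) ^ (z + 1 - 1) * ((Real.exp (-(a * x)) : ℝ) : ℂ))) x := by
    intro x hx
    have hx0 : x ≠ 0 := (one_pos.trans hx).ne'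
    have h1 := hasDerivAt_ofReal_cpow_const' (r := z - 1) hx0 (by simpa [sub_eq_iff_eq_add] using hz)
    have h1' : HasDerivAt (fun x : ℝ => (x : ℂ) ^ z) (z * (x : ℂ) ^ (z - 1)) x := by
      have := h1.const_mul z
      simp only [sub_add_cancel] at this
      refine this.congr_of_eventuallyEq (Eventually.of_forall fun y => ?_)
      simp only
      field_simp
    have h2 : HasDerivAt (fun x : ℝ => ((Real.exp (-(a * x)) : ℝ) : ℂ))
        ((Real.exp (-(a * x)) * -a : ℝ) : ℂ) x := by
      have : HasDerivAt (fun x : ℝ => Real.exp (-(a * x))) (Real.exp (-(a * x)) * -a) x := by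
        have := ((hasDerivAt_id x).const_mul a).neg.exp
        simpa using this
      exact this.ofReal_comp
    refine (h1'.mul h2).congr_deriv ?_
    simp only [add_sub_cancel_right]
    push_cast
    ring
  have hc : ContinuousWithinAt (fun x : ℝ => (x : ℂ) ^ z * ((Real.exp (-(a * x)) : ℝ) : ℂ))
      (Ici 1) 1 := by
    have : ContinuousAt (fun x : ℝ => (x : ℂ) ^ z) 1 :=
      continuousAt_ofReal_cpow_const 1 z (Or.inr one_ne_zero)
    exact (this.mul (by fun_prop)).continuousWithinAt
  have hlim : Tendsto (fun x : ℝ => (x : ℂ) ^ z * ((Real.exp (-(a * x)) : ℝ) : ℂ)) atTop (𝓝 0) := by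
    rw [tendsto_zero_iff_norm_tendsto_zero]
    refine (tendsto_rpow_mul_exp_neg_mul_atTop_nhds_zero z.re a ha).congr' ?_
    filter_upwards [eventually_gt_atTop 0] with x hx
    rw [norm_mul, norm_cpow_eq_rpow_re_of_pos hx, norm_real, Real.norm_eq_abs,
      abs_of_pos (Real.exp_pos _), neg_mul]
  have key := integral_Ioi_of_hasDerivAt_of_tendsto hc hd (i1.sub i2) hlim
  rw [integral_sub i1 i2, integral_const_mul, integral_const_mul, ← expTail_eq, ← expTail_eq]
    at key
  simp only [ofReal_one, one_cpow, mul_one, one_mul, zero_sub] at key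
  linear_combination key

theorem norm_mul_expTail_le {σ a₀ a : ℝ} (ha₀ : 0 < a₀) (ha : a₀ ≤ a) {z : ℂ} (hz : z.re ≤ σ) :
    ‖z‖ * ‖expTail z a‖ ≤ Real.exp (-(a / 2)) *
      (1 + a * ∫ x in Ioi (1 : ℝ), x ^ (σ + 1 - 1) * Real.exp (-(a₀ / 2 * x))) := by
  have ha' := ha₀.trans_le ha
  set K := ∫ x in Ioi (1 : ℝ), x ^ (σ + 1 - 1) * Real.exp (-(a₀ / 2 * x)) with hK
  have hK0 : 0 ≤ K := setIntegral_nonneg measurableSet_Ioi fun x hx => by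
    have : (0 : ℝ) < x := one_pos.trans hx
    positivity
  rcases eq_or_ne z 0 with rfl | h0
  · rw [norm_zero, zero_mul]
    positivity
  rw [← norm_mul, mul_expTail ha' h0]
  refine (norm_add_le _ _).trans ?_
  rw [norm_neg, norm_mul, norm_real, norm_real, Real.norm_eq_abs, Real.norm_eq_abs,
    abs_of_pos (Real.exp_pos _), abs_of_pos ha', mul_add, mul_one]
  refine add_le_add (Real.exp_le_exp.2 (by linarith)) ?_
  rw [mul_left_comm]
  refine mul_le_mul_of_nonneg_left (norm_expTail_le ha₀ ha ?_) ha'.le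
  simpa using hz

/-- `Γ(z) a ^ (-z)` without its `expTail`: the Mellin transform of `exp (-a x)` over `(0, 1)`. -/
theorem norm_head_le {c a : ℝ} (hc : 0 < c) (ha : 0 < a) {z : ℂ} (hz : c ≤ z.re) :
    ‖(1 / (a : ℂ)) ^ z * Gamma z - expTail z a‖ ≤ (1 / a) ^ c * Real.Gamma c := by
  have hz0 : 0 < z.re := hc.trans_le hz
  have hint : IntegrableOn (fun x : ℝ => (x : ℂ) ^ (z - 1) * ((Real.exp (-(a * x)) : ℝ) : ℂ))
      (Ioi 0) := by
    have hcont : Continuous fun x : ℝ => ((Real.exp (-(a * x)) : ℝ) : ℂ) := by fun_prop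
    refine mellinConvergent_of_isBigO_rpow_exp (b := 0) (f := fun x : ℝ =>
      ((Real.exp (-(a * x)) : ℝ) : ℂ)) ha
      (hcont.locallyIntegrable.locallyIntegrableOn _) ?_ ?_ hz0
    · refine IsBigO.of_bound 1 (Eventually.of_forall fun x => ?_)
      rw [norm_real, one_mul, neg_mul]
    · simp only [neg_zero, Real.rpow_zero]
      have : Tendsto (fun x : ℝ => ((Real.exp (-(a * x)) : ℝ) : ℂ)) (𝓝[>] 0)
        (𝓝 ((Real.exp (-(a * 0)) : ℝ) : ℂ)) := (hcont.tendsto 0).mono_left nhdsWithin_le_nhds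
      exact this.isBigO_one ℝ
  have hR : IntegrableOn (fun x : ℝ => x ^ (c - 1) * Real.exp (-(a * x))) (Ioi 0) := by
    have := integrableOn_rpow_mul_exp_neg_mul_rpow (s := c - 1) (p := 1) (b := a) (by linarith)
      one_pos ha
    simpa only [Real.rpow_one, neg_mul] using this
  have e1 : (1 / (a : ℂ)) ^ z * Gamma z =
      ∫ x in Ioi (0 : ℝ), (x : ℂ) ^ (z - 1) * ((Real.exp (-(a * x)) : ℝ) : ℂ) := by
    rw [← integral_cpow_mul_exp_neg_mul_Ioi hz0 ha]
    push_cast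
    rfl
  have hsplit : Ioi (0 : ℝ) = Ioc 0 1 ∪ Ioi 1 := (Ioc_union_Ioi_eq_Ioi zero_le_one).symm
  have e2 : (1 / (a : ℂ)) ^ z * Gamma z - expTail z a =
      ∫ x in Ioc (0 : ℝ) 1, (x : ℂ) ^ (z - 1) * ((Real.exp (-(a * x)) : ℝ) : ℂ) := by
    rw [e1, expTail_eq, hsplit, setIntegral_union Ioc_disjoint_Ioi_same measurableSet_Ioi
      (hint.mono_set Ioc_subset_Ioi_self) (hint.mono_set (Ioi_subset_Ioi zero_le_one)),
      add_sub_cancel_right]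
  rw [e2, ← Real.integral_rpow_mul_exp_neg_mul_Ioi hc ha]
  refine (norm_integral_le_integral_norm _).trans ?_
  refine (setIntegral_mono_on (hint.mono_set Ioc_subset_Ioi_self).norm
    (hR.mono_set Ioc_subset_Ioi_self) measurableSet_Ioc fun x hx => ?_).trans
    (setIntegral_mono_set hR ?_ (Eventually.of_forall Ioc_subset_Ioi_self))
  · rw [norm_mul, norm_cpow_eq_rpow_re_of_pos hx.1, norm_real, Real.norm_eq_abs,
      abs_of_pos (Real.exp_pos _)]
    refine mul_le_mul_of_nonneg_right ?_ (Real.exp_pos _).le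
    exact Real.rpow_le_rpow_of_exponent_ge hx.1 hx.2 (by simpa using hz)
  · refine (ae_restrict_mem measurableSet_Ioi).mono fun x hx => ?_
    have : (0 : ℝ) < x := hx
    simp only [Pi.zero_apply]
    positivity

/-- `Gamma_add_one` and `mul_expTail` together express `z` times the head at `z` by the head at `z +
1` and a boundary term; `norm_head_le` then applies with `c + 1`. -/
theorem norm_mul_head_le {c a : ℝ} (hc : 0 < c) (ha : 0 < a) {z : ℂ} (hz : c ≤ z.re) :
    ‖z‖ * ‖(1 / (a : ℂ)) ^ z * Gamma z - expTail z a‖ ≤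
      Real.exp (-a) + (1 / a) ^ c * Real.Gamma (c + 1) := by
  have h0 : z ≠ 0 := fun h => by simp [h] at hz; linarith
  have ha' : (a : ℂ) ≠ 0 := by exact_mod_cast ha.ne'
  have e : z * ((1 / (a : ℂ)) ^ z * Gamma z - expTail z a) = (Real.exp (-a) : ℝ) +
      a * ((1 / (a : ℂ)) ^ (z + 1) * Gamma (z + 1) - expTail (z + 1) a) := by
    rw [mul_sub, mul_expTail ha h0, Gamma_add_one z h0, cpow_add _ _ (by simpa using ha'), cpow_one]
    field_simp
    ring
  rw [← norm_mul, e]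
  refine (norm_add_le _ _).trans ?_
  rw [norm_mul, norm_real, norm_real, Real.norm_eq_abs, Real.norm_eq_abs,
    abs_of_pos (Real.exp_pos _), abs_of_pos ha]
  refine add_le_add le_rfl ?_
  have := norm_head_le (c := c + 1) (by linarith) ha (z := z + 1) (by simpa using hz)
  refine (mul_le_mul_of_nonneg_left this ha.le).trans (le_of_eq ?_)
  rw [Real.rpow_add (by positivity), Real.rpow_one]
  field_simp

/-! ### Tails of theta series -/

/-- The part over `x > 1` of the Mellin transform of `x ↦ ∑ n, c n * n ^ k * exp (-b n² x)`. -/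
noncomputable def thetaTail (c : ℕ → ℂ) (k : ℕ) (b : ℝ) (s : ℂ) : ℂ :=
  ∑' n : ℕ, c n * (n : ℂ) ^ k * expTail ((s + k) / 2) (b * n ^ 2)

/-- A single majorant, independent of `c` and of `s` in the half-plane, gives holomorphy by uniform
convergence and also the decay in `s`. -/
theorem exists_summable_thetaTail_bound (k : ℕ) {b : ℝ} (hb : 0 < b) (σ : ℝ) :
    ∃ v : ℕ → ℝ, Summable v ∧ (∀ n, 0 ≤ v n) ∧ ∀ c : ℕ → ℂ, (∀ n, ‖c n‖ ≤ 1) → c 0 = 0 →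
      ∀ (n : ℕ) (s : ℂ), s.re ≤ σ →
      ‖c n * (n : ℂ) ^ k * expTail ((s + k) / 2) (b * n ^ 2)‖ ≤ v n ∧
      ‖(s + k) / 2‖ * ‖c n * (n : ℂ) ^ k * expTail ((s + k) / 2) (b * n ^ 2)‖ ≤ v n := by
  set τ := (σ + k) / 2
  set K₁ := ∫ x in Ioi (1 : ℝ), x ^ (τ - 1) * Real.exp (-(b / 2 * x)) with hK₁
  set K₂ := ∫ x in Ioi (1 : ℝ), x ^ (τ + 1 - 1) * Real.exp (-(b / 2 * x)) with hK₂
  have hK₁0 : 0 ≤ K₁ := setIntegral_nonneg measurableSet_Ioi fun x hx => by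
    have : (0 : ℝ) < x := one_pos.trans hx
    positivity
  have hK₂0 : 0 ≤ K₂ := setIntegral_nonneg measurableSet_Ioi fun x hx => by
    have : (0 : ℝ) < x := one_pos.trans hx
    positivity
  -- In `K₁ + 1` the `1` is for the boundary term of `norm_mul_expTail_le`. The power `k + 2` in
  -- `s2` absorbs the factor `a = b * n ^ 2` of that bound.
  have s1 := (Real.summable_pow_mul_exp_neg_nat_mul k (half_pos hb)).mul_left (K₁ + 1)
  have s2 := (Real.summable_pow_mul_exp_neg_nat_mul (k + 2) (half_pos hb)).mul_left (b * K₂)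
  refine ⟨_, s1.add s2, fun n => by positivity, fun c hc hc0 n s hs => ?_⟩
  rcases Nat.eq_zero_or_pos n with rfl | hn
  · rw [hc0, zero_mul, zero_mul, norm_zero, mul_zero]
    have : 0 ≤ (K₁ + 1) * ((0 : ℕ) ^ k * Real.exp (-(b / 2) * (0 : ℕ))) +
      b * K₂ * ((0 : ℕ) ^ (k + 2) * Real.exp (-(b / 2) * (0 : ℕ))) := by positivity
    exact ⟨this, this⟩
  have hn1 : (1 : ℝ) ≤ n := by exact_mod_cast hn
  have hn2 : (n : ℝ) ≤ (n : ℝ) ^ 2 := by nlinarith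
  have ha : b ≤ b * (n : ℝ) ^ 2 := by nlinarith
  have hz : ((s + k) / 2).re ≤ τ := by
    have : ((s + k) / 2).re = (s.re + k) / 2 := by simp
    rw [this]
    simp only [τ]
    linarith
  have hexp : Real.exp (-(b * (n : ℝ) ^ 2 / 2)) ≤ Real.exp (-(b / 2) * n) :=
    Real.exp_le_exp.2 (by nlinarith)
  have e : ‖c n * (n : ℂ) ^ k * expTail ((s + k) / 2) (b * n ^ 2)‖ ≤
      (n : ℝ) ^ k * ‖expTail ((s + k) / 2) (b * n ^ 2)‖ := by
    rw [norm_mul, norm_mul, norm_pow, norm_natCast]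
    refine mul_le_mul_of_nonneg_right ?_ (norm_nonneg _)
    exact mul_le_of_le_one_left (by positivity) (hc n)
  constructor
  · refine e.trans ((mul_le_mul_of_nonneg_left (norm_expTail_le hb ha hz) (by positivity)).trans ?_)
    calc (n : ℝ) ^ k * (Real.exp (-(b * (n : ℝ) ^ 2 / 2)) * K₁)
        ≤ (n : ℝ) ^ k * (Real.exp (-(b / 2) * n) * (K₁ + 1)) := by gcongr; linarith
      _ = (K₁ + 1) * ((n : ℝ) ^ k * Real.exp (-(b / 2) * n)) := by ring
      _ ≤ _ := le_add_of_nonneg_right (by positivity)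
  · refine (mul_le_mul_of_nonneg_left e (norm_nonneg _)).trans ?_
    rw [mul_left_comm]
    refine (mul_le_mul_of_nonneg_left (norm_mul_expTail_le hb ha hz) (by positivity)).trans ?_
    calc (n : ℝ) ^ k * (Real.exp (-(b * (n : ℝ) ^ 2 / 2)) * (1 + b * (n : ℝ) ^ 2 * K₂))
        ≤ (n : ℝ) ^ k * (Real.exp (-(b / 2) * n) * ((K₁ + 1) + b * (n : ℝ) ^ 2 * K₂)) := by
          gcongr; linarith
      _ = _ := by ring

theorem summable_thetaTail {c : ℕ → ℂ} (hc : ∀ n, ‖c n‖ ≤ 1) (hc0 : c 0 = 0) (k : ℕ) {b : ℝ}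
    (hb : 0 < b) (s : ℂ) :
    Summable fun n : ℕ => c n * (n : ℂ) ^ k * expTail ((s + k) / 2) (b * n ^ 2) := by
  obtain ⟨v, hv, -, H⟩ := exists_summable_thetaTail_bound k hb s.re
  exact Summable.of_norm_bounded hv fun n => (H c hc hc0 n s le_rfl).1

theorem differentiable_thetaTail {c : ℕ → ℂ} (hc : ∀ n, ‖c n‖ ≤ 1) (hc0 : c 0 = 0) (k : ℕ) {b : ℝ}
    (hb : 0 < b) : Differentiable ℂ (thetaTail c k b) := by
  intro s
  obtain ⟨v, hv, -, H⟩ := exists_summable_thetaTail_bound k hb (s.re + 1)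
  have ho : IsOpen {w : ℂ | w.re < s.re + 1} := isOpen_lt continuous_re continuous_const
  refine (differentiableOn_tsum_of_summable_norm hv (fun n => ?_) ho
    fun n w hw => (H c hc hc0 n w (le_of_lt hw)).1).differentiableAt (ho.mem_nhds (by simp))
  rcases Nat.eq_zero_or_pos n with rfl | hn
  · simp only [hc0, zero_mul]
    fun_prop
  · have hn0 : (0 : ℝ) < n := by exact_mod_cast hn
    exact (((differentiable_expTail (a := b * n ^ 2) (by positivity)).comp
      (f := fun s : ℂ => (s + k) / 2) (by fun_prop)).const_mul _).differentiableOn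

/-- `thetaTail` is bounded, and decays, in left half-planes. -/
theorem exists_thetaTail_bound {c : ℕ → ℂ} (hc : ∀ n, ‖c n‖ ≤ 1) (hc0 : c 0 = 0) (k : ℕ) {b : ℝ}
    (hb : 0 < b) (σ : ℝ) : ∃ C : ℝ, ∀ s : ℂ, s.re ≤ σ →
      ‖thetaTail c k b s‖ ≤ C ∧ ‖(s + k) / 2‖ * ‖thetaTail c k b s‖ ≤ C := by
  obtain ⟨v, hv, hv0, H⟩ := exists_summable_thetaTail_bound k hb σ
  refine ⟨∑' n, v n, fun s hs => ⟨?_, ?_⟩⟩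
  · exact tsum_of_norm_bounded hv.hasSum fun n => (H c hc hc0 n s hs).1
  · rw [← norm_mul, thetaTail, ← tsum_mul_left]
    refine tsum_of_norm_bounded hv.hasSum fun n => ?_
    rw [norm_mul]
    exact (H c hc hc0 n s hs).2

theorem ofReal_cpow_eq_exp {x : ℝ} (hx : 0 < x) (z : ℂ) : (x : ℂ) ^ z = exp (Real.log x * z) := by
  rw [cpow_def_of_ne_zero (by exact_mod_cast hx.ne'), ← ofReal_log hx.le]

/-- The weight `n ^ k` cancels against the shift of the argument by `k / 2`. Hence the theta term
with weight `n ^ k` corresponds to the Dirichlet term `1 / n ^ s`. -/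
theorem pow_mul_cpow_eq (k : ℕ) {b : ℝ} (hb : 0 < b) {n : ℕ} (hn : 0 < n) (s : ℂ) :
    (n : ℂ) ^ k * (1 / ((b * n ^ 2 : ℝ) : ℂ)) ^ ((s + k) / 2) =
      (1 / (b : ℂ)) ^ ((s + k) / 2) / (n : ℂ) ^ s := by
  have hn0 : (0 : ℝ) < n := by exact_mod_cast hn
  have e1 : (1 / ((b * n ^ 2 : ℝ) : ℂ)) = ((1 / (b * n ^ 2) : ℝ) : ℂ) := by push_cast; rfl
  have e2 : (1 / (b : ℂ)) = ((1 / b : ℝ) : ℂ) := by push_cast; rfl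
  have e3 : (n : ℂ) = ((n : ℝ) : ℂ) := by push_cast; rfl
  rw [e1, e2, e3, ← cpow_natCast, ofReal_cpow_eq_exp hn0, ofReal_cpow_eq_exp hn0,
    ofReal_cpow_eq_exp (by positivity), ofReal_cpow_eq_exp (by positivity), ← exp_add, ← exp_sub,
    one_div, one_div, Real.log_inv, Real.log_inv, Real.log_mul hb.ne' (by positivity), Real.log_pow]
  congr 1
  push_cast
  ring

/-- The completed Dirichlet series minus its `thetaTail` decays in the half-plane `2 ≤ re s`. -/
theorem exists_completed_sub_thetaTail_bound {c : ℕ → ℂ} (hc : ∀ n, ‖c n‖ ≤ 1) (hc0 : c 0 = 0)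
    (k : ℕ) {b : ℝ} (hb : 0 < b) : ∃ C : ℝ, ∀ s : ℂ, 2 ≤ s.re → ‖(s + k) / 2‖ *
      ‖(1 / (b : ℂ)) ^ ((s + k) / 2) * Gamma ((s + k) / 2) * LSeries c s - thetaTail c k b s‖ ≤
      C := by
  -- `d` is the least real part of `(s + k) / 2` in the half-plane, and `n ^ k * n ^ (-2 * d) = n ^
  -- (-2)` is summable.
  set d : ℝ := (2 + k) / 2 with hd
  have hd0 : 0 < d := by positivity
  have s1 := Real.summable_pow_mul_exp_neg_nat_mul k hb
  have s2 := (Real.summable_one_div_nat_pow.2 one_lt_two).mul_left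
    ((1 / b) ^ d * Real.Gamma (d + 1))
  refine ⟨∑' n : ℕ, ((n : ℝ) ^ k * Real.exp (-b * n) +
      (1 / b) ^ d * Real.Gamma (d + 1) * (1 / (n : ℝ) ^ 2)), fun s hs => ?_⟩
  have hL : Summable (LSeries.term c s) :=
    LSeriesSummable_of_bounded_of_one_lt_re (m := 1) (fun n _ => hc n) (by linarith)
  set z := (s + k) / 2 with hz
  have hzre : d ≤ z.re := by
    have : z.re = (s.re + k) / 2 := by simp [hz]
    rw [this, hd]
    linarith
  rw [← norm_mul, thetaTail, LSeries, ← tsum_mul_left,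
    ← (hL.mul_left _).tsum_sub (summable_thetaTail hc hc0 k hb s), ← tsum_mul_left]
  refine tsum_of_norm_bounded (s1.add s2).hasSum fun n => ?_
  rcases Nat.eq_zero_or_pos n with rfl | hn
  · simp only [LSeries.term_zero, hc0, mul_zero, zero_mul, sub_zero, norm_zero]
    have := Real.Gamma_nonneg_of_nonneg (s := d + 1) (by linarith)
    positivity
  have hn1 : (1 : ℝ) ≤ n := by exact_mod_cast hn
  have hn0 : (0 : ℝ) < n := by linarith
  have ha : 0 < b * (n : ℝ) ^ 2 := by positivity
  have e : (1 / (b : ℂ)) ^ z * Gamma z * LSeries.term c s n -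
      c n * (n : ℂ) ^ k * expTail z (b * n ^ 2) =
      c n * (n : ℂ) ^ k * ((1 / ((b * n ^ 2 : ℝ) : ℂ)) ^ z * Gamma z - expTail z (b * n ^ 2)) := by
    have := pow_mul_cpow_eq k hb hn s
    rw [LSeries.term_of_ne_zero hn.ne', ← hz] at *
    linear_combination -(c n * Gamma z) * this
  rw [e, norm_mul, norm_mul, norm_mul, norm_pow, norm_natCast]
  have h1 := norm_mul_head_le hd0 ha hzre
  have h2 : Real.exp (-(b * (n : ℝ) ^ 2)) ≤ Real.exp (-b * n) := Real.exp_le_exp.2 (by nlinarith)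
  have h3 : (n : ℝ) ^ k * (1 / (b * (n : ℝ) ^ 2)) ^ d = (1 / b) ^ d * (1 / (n : ℝ) ^ 2) := by
    rw [one_div, one_div, one_div, mul_inv, Real.mul_rpow (by positivity) (by positivity),
      Real.inv_rpow (by positivity) d, Real.inv_rpow (by positivity) d,
      ← Real.rpow_natCast_mul hn0.le, hd]
    have : ((2 : ℕ) : ℝ) * ((2 + k) / 2) = ((k + 2 : ℕ) : ℝ) := by push_cast; ring
    rw [this, Real.rpow_natCast, pow_add]
    field_simp
  calc ‖z‖ * (‖c n‖ * (n : ℝ) ^ k *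
        ‖(1 / ((b * n ^ 2 : ℝ) : ℂ)) ^ z * Gamma z - expTail z (b * n ^ 2)‖)
      ≤ ‖z‖ * (1 * (n : ℝ) ^ k *
        ‖(1 / ((b * n ^ 2 : ℝ) : ℂ)) ^ z * Gamma z - expTail z (b * n ^ 2)‖) := by
        gcongr
        exact hc n
    _ = (n : ℝ) ^ k * (‖z‖ *
        ‖(1 / ((b * n ^ 2 : ℝ) : ℂ)) ^ z * Gamma z - expTail z (b * n ^ 2)‖) := by ring
    _ ≤ (n : ℝ) ^ k * (Real.exp (-b * n) + (1 / (b * (n : ℝ) ^ 2)) ^ d * Real.Gamma (d + 1)) := by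
        gcongr
        linarith
    _ = _ := by linear_combination Real.Gamma (d + 1) * h3

/-! ### Bounds for the Gamma factor and the Euler factors away from their poles -/

theorem norm_Gamma_le {z : ℂ} (hz : 0 < z.re) : ‖Gamma z‖ ≤ Real.Gamma z.re := by
  rw [Gamma_eq_integral hz, Real.Gamma_eq_integral hz, GammaIntegral]
  refine (norm_integral_le_integral_norm _).trans (le_of_eq ?_)
  refine setIntegral_congr_fun measurableSet_Ioi fun x hx => ?_
  rw [norm_mul, norm_cpow_eq_rpow_re_of_pos hx, norm_real, Real.norm_eq_abs,
    abs_of_pos (Real.exp_pos _), sub_re, one_re]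

theorem isClosed_setOf_dist_nonpos_int (δ : ℝ) : IsClosed {z : ℂ | ∀ m : ℕ, δ ≤ ‖z + m‖} := by
  have : {z : ℂ | ∀ m : ℕ, δ ≤ ‖z + m‖} = ⋂ m : ℕ, {z : ℂ | δ ≤ ‖z + m‖} := by
    ext
    simp
  rw [this]
  exact isClosed_iInter fun m => isClosed_le continuous_const (by fun_prop)

theorem ne_neg_nat_of_le_norm {δ : ℝ} (hδ : 0 < δ) {z : ℂ} (hz : ∀ m : ℕ, δ ≤ ‖z + m‖) (m : ℕ) :
    z ≠ -m := by
  rintro rfl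
  have := hz m
  rw [neg_add_cancel, norm_zero] at this
  linarith

/-- Away from its poles, `K ^ z * Γ(z)` is bounded in left half-planes. -/
theorem exists_cpow_mul_Gamma_bound {δ K c : ℝ} (hδ : 0 < δ) (hK : 0 < K) (hc : 0 < c) :
    ∃ C : ℝ, ∀ z : ℂ, z.re ≤ c + 1 → (∀ m : ℕ, δ ≤ ‖z + m‖) → ‖(K : ℂ) ^ z * Gamma z‖ ≤ C := by
  have hK' : (K : ℂ) ≠ 0 := by exact_mod_cast hK.ne'
  obtain ⟨C₀, hC₀⟩ : ∃ C₀ : ℝ, ∀ x ∈ Icc c (c + 1), K ^ x * Real.Gamma x ≤ C₀ := by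
    have hcont : ContinuousOn (fun x => K ^ x * Real.Gamma x) (Icc c (c + 1)) := by
      refine ContinuousOn.mul (Real.continuous_const_rpow hK.ne').continuousOn fun x hx => ?_
      refine (Real.differentiableAt_Gamma fun m => ?_).continuousAt.continuousWithinAt
      have : (0 : ℝ) < x := hc.trans_le hx.1
      have hm : (0 : ℝ) ≤ m := m.cast_nonneg
      linarith
    obtain ⟨C, hC⟩ := isCompact_Icc.exists_bound_of_continuousOn hcont
    exact ⟨C, fun x hx => (le_abs_self _).trans (hC x hx)⟩
  obtain ⟨C₁, hC₁⟩ : ∃ C₁ : ℝ, ∀ z ∈ Metric.closedBall (0 : ℂ) (1 / K) ∩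
      {z : ℂ | ∀ m : ℕ, δ ≤ ‖z + m‖}, ‖(K : ℂ) ^ z * Gamma z‖ ≤ C₁ := by
    refine ((isCompact_closedBall _ _).inter_right
      (isClosed_setOf_dist_nonpos_int δ)).exists_bound_of_continuousOn fun z hz => ?_
    refine (ContinuousAt.mul ?_ ?_).continuousWithinAt
    · exact (continuousAt_const_cpow hK')
    · exact (differentiableAt_Gamma z (ne_neg_nat_of_le_norm hδ hz.2)).continuousAt
  refine ⟨max C₀ C₁, fun z hz hzm => ?_⟩
  obtain ⟨N, hN⟩ := exists_nat_ge (c - z.re)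
  -- `N` counts the unit steps to the right needed to reach the strip `c ≤ re ≤ c + 1`, where the
  -- real Gamma function bounds everything. A step from `z` to `z + 1` multiplies the function by `K
  -- * z`, which has norm at least `1` outside the ball of radius `1 / K`; inside that ball
  -- compactness suffices.
  induction N generalizing z with
  | zero =>
    have h1 : c ≤ z.re := by simpa using hN
    refine le_trans ?_ ((hC₀ z.re ⟨h1, hz⟩).trans (le_max_left _ _))
    rw [norm_mul, norm_cpow_eq_rpow_re_of_pos hK]
    exact mul_le_mul_of_nonneg_left (norm_Gamma_le (hc.trans_le h1)) (by positivity)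
  | succ N ih =>
    rcases le_or_gt c z.re with h1 | h1
    · exact ih z hz hzm (by linarith [(N.cast_nonneg : (0 : ℝ) ≤ N)])
    rcases le_or_gt ‖z‖ (1 / K) with h2 | h2
    · exact (hC₁ z ⟨by simpa using h2, hzm⟩).trans (le_max_right _ _)
    have hz0 : z ≠ 0 := by
      rintro rfl
      simpa [hδ.not_ge] using hzm 0
    have h3 := ih (z + 1) (by simpa using h1.le)
      (fun m => by simpa [add_assoc, add_comm (1 : ℂ)] using hzm (m + 1))
      (by simp only [add_re, one_re]; push_cast at hN; linarith)
    rw [Gamma_add_one z hz0, cpow_add _ _ hK', cpow_one] at h3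
    refine le_trans ?_ h3
    have e : (K : ℂ) ^ z * K * (z * Gamma z) = (K * z) * ((K : ℂ) ^ z * Gamma z) := by ring
    rw [e, norm_mul _ ((K : ℂ) ^ z * Gamma z), norm_mul (K : ℂ), norm_real, Real.norm_eq_abs,
      abs_of_pos hK]
    refine le_mul_of_one_le_left (norm_nonneg _) ?_
    rw [div_lt_iff₀' hK] at h2
    exact h2.le

/-- `z * K ^ z * Γ(z) = K ^ (z + 1) * Γ(z + 1) / K`, so the previous bound at `z + 1` gives the
decay at `z`. -/
theorem exists_norm_mul_cpow_mul_Gamma_bound {δ K c : ℝ} (hδ : 0 < δ) (hK : 0 < K) (hc : 0 < c) :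
    ∃ C : ℝ, ∀ z : ℂ, z.re ≤ c → (∀ m : ℕ, δ ≤ ‖z + m‖) →
      ‖z‖ * ‖(K : ℂ) ^ z * Gamma z‖ ≤ C := by
  obtain ⟨C, hC⟩ := exists_cpow_mul_Gamma_bound hδ hK hc
  refine ⟨C / K, fun z hz hzm => ?_⟩
  have hK' : (K : ℂ) ≠ 0 := by exact_mod_cast hK.ne'
  have hz0 : z ≠ 0 := by
    rintro rfl
    simpa [hδ.not_ge] using hzm 0
  have h3 := hC (z + 1) (by simpa using hz)
    (fun m => by simpa [add_assoc, add_comm (1 : ℂ)] using hzm (m + 1))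
  rw [Gamma_add_one z hz0, cpow_add _ _ hK', cpow_one] at h3
  have e : (K : ℂ) ^ z * K * (z * Gamma z) = K * (z * ((K : ℂ) ^ z * Gamma z)) := by ring
  rw [e, norm_mul, norm_real, Real.norm_eq_abs, abs_of_pos hK, norm_mul] at h3
  rwa [le_div_iff₀' hK]

theorem exists_g_bound {q : ℕ} [NeZero q] (χ : DirichletCharacter ℂ q) {δ : ℝ} (hδ : 0 < δ) :
    ∃ C : ℝ, ∀ s : ℂ, s.re ≤ 2 → (∀ h : ℕ, δ ≤ ‖s + 2 * h + kappa χ‖) →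
      ‖(s + kappa χ) / 2‖ * ‖g χ s‖ ≤ C := by
  have hq : (0 : ℝ) < q := by exact_mod_cast NeZero.pos q
  obtain ⟨C, hC⟩ := exists_norm_mul_cpow_mul_Gamma_bound (half_pos hδ)
    (div_pos hq Real.pi_pos) (c := (2 + kappa χ) / 2) (by positivity)
  refine ⟨C, fun s hs hsm => hC _ ?_ fun m => ?_⟩
  · have : ((s + kappa χ) / 2).re = (s.re + kappa χ) / 2 := by simp
    rw [this]
    linarith
  · have e : (s + kappa χ) / 2 + m = (s + 2 * m + kappa χ) / 2 := by ring
    rw [e, norm_div, RCLike.norm_ofNat]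
    linarith [hsm m]

theorem norm_chi_eq_one {q : ℕ} [NeZero q] (χ : DirichletCharacter ℂ q) {p : ℕ} (hp : p.Prime)
    (hpq : ¬ p ∣ q) : ‖χ (p : ZMod q)‖ = 1 := by
  have h : IsUnit (p : ZMod q) := (ZMod.isUnit_iff_coprime p q).2 ((hp.coprime_iff_not_dvd).2 hpq)
  exact χ.unit_norm_eq_one h.unit

theorem chi_eq_zero {q : ℕ} (χ : DirichletCharacter ℂ q) {p : ℕ} (hp : p.Prime)
    (hpq : p ∣ q) : χ (p : ZMod q) = 0 := by
  refine χ.map_nonunit fun h => ?_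
  exact (hp.coprime_iff_not_dvd).1 ((ZMod.isUnit_iff_coprime p q).1 h) hpq

theorem mem_primesUpTo {u : ℝ} {p : ℕ} : p ∈ primesUpTo u ↔ p < ⌊u⌋₊ + 1 ∧ p.Prime := by
  simp [primesUpTo]

theorem mem_goodPrimes {q : ℕ} {u : ℝ} {p : ℕ} :
    p ∈ goodPrimes q u ↔ p ∈ primesUpTo u ∧ ¬ p ∣ q := by
  simp [goodPrimes]

theorem prime_of_mem_goodPrimes {q : ℕ} {u : ℝ} {p : ℕ} (hp : p ∈ goodPrimes q u) : p.Prime :=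
  (mem_primesUpTo.1 (mem_goodPrimes.1 hp).1).2

/-- Since `‖χ p‖ = 1`, the Euler factor is `1 / (1 - exp (-w))` with `w = log p * (s - ρ)`. Any pole
`ρ` may be the base point, because the poles differ by periods. -/
theorem chi_div_cpow_eq {q : ℕ} [NeZero q] (χ : DirichletCharacter ℂ q) {p : ℕ} (hp : p.Prime)
    (hpq : ¬ p ∣ q) (h : ℤ) (s : ℂ) :
    χ (p : ZMod q) / (p : ℂ) ^ s = exp (-((Real.log p : ℝ) * (s - eulerPole χ p h))) := by
  have hp0 : (0 : ℝ) < p := by exact_mod_cast hp.pos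
  have hlog : Real.log p ≠ 0 := (Real.log_pos (by exact_mod_cast hp.one_lt)).ne'
  have hlog' : ((Real.log p : ℝ) : ℂ) ≠ 0 := by exact_mod_cast hlog
  have e1 : χ (p : ZMod q) = exp (arg (χ (p : ZMod q)) * I) := by
    conv_lhs => rw [← norm_mul_exp_arg_mul_I (χ (p : ZMod q)), norm_chi_eq_one χ hp hpq]
    simp
  have e2 : (p : ℂ) ^ s = exp ((Real.log p : ℝ) * s) := by
    rw [← ofReal_cpow_eq_exp hp0]
    push_cast
    rfl
  have e3 : -((Real.log p : ℝ) * (s - eulerPole χ p h)) =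
      arg (χ (p : ZMod q)) * I - (Real.log p : ℝ) * s + h * (2 * Real.pi * I) := by
    rw [eulerPole]
    push_cast at hlog' ⊢
    field_simp
    ring
  rw [e3, exp_add, exp_int_mul_two_pi_mul_I, mul_one, exp_sub, ← e1, ← e2]

theorem eulerPole_sub {q : ℕ} (χ : DirichletCharacter ℂ q) {p : ℕ} (hp : p.Prime) (h : ℤ) :
    (Real.log p : ℂ) * eulerPole χ p h =
      (Real.log p : ℂ) * eulerPole χ p 0 + 2 * Real.pi * I * h := by
  have hlog : Real.log p ≠ 0 := (Real.log_pos (by exact_mod_cast hp.one_lt)).ne'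
  have hlog' : ((Real.log p : ℝ) : ℂ) ≠ 0 := by exact_mod_cast hlog
  rw [eulerPole, eulerPole]
  push_cast at hlog' ⊢
  field_simp
  ring

theorem one_sub_exp_neg_ne_zero {η : ℝ} (hη : 0 < η) {w : ℂ}
    (hw : ∀ h : ℤ, η ≤ ‖w - 2 * Real.pi * I * h‖) : 1 - exp (-w) ≠ 0 := by
  intro h0
  have : exp (-w) = 1 := (sub_eq_zero.1 h0).symm
  obtain ⟨n, hn⟩ := exp_eq_one_iff.1 this
  have := hw (-n)
  have e : w - 2 * Real.pi * I * ((-n : ℤ) : ℂ) = 0 := by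
    push_cast
    linear_combination -hn
  rw [e, norm_zero] at this
  linarith

/-- `1 / (1 - exp (-w))` is bounded away from its poles. -/
theorem exists_inv_one_sub_exp_bound {η : ℝ} (hη : 0 < η) :
    ∃ C : ℝ, ∀ w : ℂ, (∀ h : ℤ, η ≤ ‖w - 2 * Real.pi * I * h‖) → ‖1 / (1 - exp (-w))‖ ≤ C := by
  -- One period of the function in the strip `|re w| ≤ 1`, with the neighbourhoods of the poles
  -- removed. Outside the strip, `‖exp (-w)‖` is bounded away from `1`.
  set S : Set ℂ := (Icc (-1) 1 ×ℂ Icc (-Real.pi) Real.pi) ∩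
    {w : ℂ | ∀ h : ℤ, η ≤ ‖w - 2 * Real.pi * I * h‖} with hS
  have hScl : IsClosed {w : ℂ | ∀ h : ℤ, η ≤ ‖w - 2 * Real.pi * I * h‖} := by
    have : {w : ℂ | ∀ h : ℤ, η ≤ ‖w - 2 * Real.pi * I * h‖} =
        ⋂ h : ℤ, {w : ℂ | η ≤ ‖w - 2 * Real.pi * I * h‖} := by
      ext
      simp
    rw [this]
    exact isClosed_iInter fun m => isClosed_le continuous_const (by fun_prop)
  have hSc : IsCompact S := (isCompact_Icc.reProdIm isCompact_Icc).inter_right hScl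
  obtain ⟨C, hC⟩ := hSc.exists_bound_of_continuousOn (f := fun w => 1 / (1 - exp (-w)))
    (ContinuousOn.div (by fun_prop) (by fun_prop) fun w hw => one_sub_exp_neg_ne_zero hη hw.2)
  have he1 : Real.exp (-1) < 1 := by
    simp
  refine ⟨max C (1 / (1 - Real.exp (-1))), fun w hw => ?_⟩
  have hn : ‖exp (-w)‖ = Real.exp (-w.re) := by rw [norm_exp, neg_re]
  have hge : ∀ {x : ℝ}, 1 - Real.exp (-1) ≤ x → 1 / x ≤ 1 / (1 - Real.exp (-1)) := fun hx =>
    one_div_le_one_div_of_le (by linarith) hx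
  rcases le_or_gt 1 w.re with h1 | h1
  · refine le_trans ?_ (le_max_right _ _)
    rw [norm_div, norm_one]
    refine hge ?_
    have h2 := norm_sub_norm_le (1 : ℂ) (exp (-w))
    rw [norm_one, hn] at h2
    have : Real.exp (-w.re) ≤ Real.exp (-1) := Real.exp_le_exp.2 (by linarith)
    linarith
  rcases le_or_gt w.re (-1) with h3 | h3
  · refine le_trans ?_ (le_max_right _ _)
    rw [norm_div, norm_one]
    refine hge ?_
    have h2 := norm_sub_norm_le (exp (-w)) 1
    rw [norm_one, hn, norm_sub_rev] at h2
    have h4 := Real.add_one_le_exp (-w.re)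
    have := Real.exp_pos (-1)
    linarith
  refine le_trans ?_ (le_max_left _ _)
  -- Translation by the nearest period brings `w` into `S`.
  set m : ℤ := round (w.im / (2 * Real.pi)) with hm
  have hpi := Real.pi_pos
  have hexp : exp (-w) = exp (-(w - 2 * Real.pi * I * m)) := by
    have : -(w - 2 * Real.pi * I * m) = -w + m * (2 * Real.pi * I) := by ring
    rw [this, exp_add, exp_int_mul_two_pi_mul_I, mul_one]
  have hre : (w - 2 * Real.pi * I * m).re = w.re := by simp
  have him : (w - 2 * Real.pi * I * m).im = w.im - 2 * Real.pi * m := by simp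
  rw [hexp]
  refine hC _ ⟨?_, fun h => ?_⟩
  · rw [mem_reProdIm, hre, him]
    refine ⟨⟨h3.le, h1.le⟩, ?_⟩
    have h5 := abs_sub_round (w.im / (2 * Real.pi))
    rw [← hm] at h5
    have h6 : w.im - 2 * Real.pi * m = 2 * Real.pi * (w.im / (2 * Real.pi) - m) := by field_simp
    rw [mem_Icc, ← abs_le, h6, abs_mul, abs_of_pos (by positivity)]
    nlinarith
  · have := hw (m + h)
    push_cast at this
    convert this using 2
    ring

/-- `L_u` is bounded away from its poles. -/
theorem exists_LU_bound {q : ℕ} [NeZero q] (χ : DirichletCharacter ℂ q) (u : ℝ) {δ : ℝ}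
    (hδ : 0 < δ) : ∃ C : ℝ, 0 ≤ C ∧ ∀ s : ℂ,
      (∀ p ∈ goodPrimes q u, ∀ h : ℤ, δ ≤ ‖s - eulerPole χ p h‖) → ‖LU χ u s‖ ≤ C := by
  have key : ∀ p ∈ primesUpTo u, ∃ C : ℝ, ∀ s : ℂ,
      (∀ p ∈ goodPrimes q u, ∀ h : ℤ, δ ≤ ‖s - eulerPole χ p h‖) →
      ‖1 / (1 - χ (p : ZMod q) / (p : ℂ) ^ s)‖ ≤ C := by
    intro p hp
    have hpp := (mem_primesUpTo.1 hp).2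
    by_cases hpq : p ∣ q
    · exact ⟨1, fun s _ => by simp [chi_eq_zero χ hpp hpq]⟩
    have hlog : 0 < Real.log p := Real.log_pos (by exact_mod_cast hpp.one_lt)
    obtain ⟨C, hC⟩ := exists_inv_one_sub_exp_bound (mul_pos hlog hδ)
    refine ⟨C, fun s hs => ?_⟩
    rw [chi_div_cpow_eq χ hpp hpq 0]
    refine hC _ fun h => ?_
    have e : (Real.log p : ℂ) * (s - eulerPole χ p 0) - 2 * Real.pi * I * h =
        (Real.log p : ℂ) * (s - eulerPole χ p h) := by
      linear_combination eulerPole_sub χ hpp h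
    rw [e, norm_mul, norm_real, Real.norm_eq_abs, abs_of_pos hlog]
    exact mul_le_mul_of_nonneg_left (hs p (mem_goodPrimes.2 ⟨hp, hpq⟩) h) hlog.le
  choose! C hC using key
  refine ⟨∏ p ∈ primesUpTo u, |C p|, Finset.prod_nonneg fun _ _ => abs_nonneg _, fun s hs => ?_⟩
  rw [LU, norm_prod]
  exact Finset.prod_le_prod (fun _ _ => norm_nonneg _) fun p hp =>
    (hC p hp s hs).trans (le_abs_self _)

theorem one_sub_chi_div_eq_zero {q : ℕ} [NeZero q] (χ : DirichletCharacter ℂ q) {p : ℕ}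
    (hp : p.Prime) (hpq : ¬ p ∣ q) {s : ℂ} (hs : 1 - χ (p : ZMod q) / (p : ℂ) ^ s = 0) :
    ∃ h : ℤ, s = eulerPole χ p h := by
  have hlog : Real.log p ≠ 0 := (Real.log_pos (by exact_mod_cast hp.one_lt)).ne'
  have hlog' : ((Real.log p : ℝ) : ℂ) ≠ 0 := by exact_mod_cast hlog
  rw [chi_div_cpow_eq χ hp hpq 0] at hs
  obtain ⟨n, hn⟩ := exp_eq_one_iff.1 (sub_eq_zero.1 hs).symm
  refine ⟨-n, mul_left_cancel₀ hlog' ?_⟩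
  rw [eulerPole_sub χ hp]
  push_cast
  push_cast at hn
  linear_combination -hn

theorem chi_div_cpow_eulerPole {q : ℕ} [NeZero q] (χ : DirichletCharacter ℂ q) {p : ℕ}
    (hp : p.Prime) (hpq : ¬ p ∣ q) (h : ℤ) :
    χ (p : ZMod q) / (p : ℂ) ^ eulerPole χ p h = 1 := by
  rw [chi_div_cpow_eq χ hp hpq h]
  simp

/-! ### Coincidences among the Euler poles -/

/-- `χ p` is a root of unity of order dividing `φ(q)`, so every pole is a rational multiple of `2 π
i / log p`. A common pole of two factors is then a rational relation between two logarithms of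
primes. -/
theorem exists_int_totient_mul_arg {q : ℕ} [NeZero q] (χ : DirichletCharacter ℂ q) {p : ℕ}
    (hp : p.Prime) (hpq : ¬ p ∣ q) (h : ℤ) :
    ∃ a : ℤ, (q.totient : ℝ) * (arg (χ (p : ZMod q)) + 2 * Real.pi * h) = 2 * Real.pi * a := by
  have hu : IsUnit (p : ZMod q) := (ZMod.isUnit_iff_coprime p q).2 ((hp.coprime_iff_not_dvd).2 hpq)
  have h1 : χ (p : ZMod q) ^ q.totient = 1 := by
    rw [← hu.unit_spec, ← map_pow, ← Units.val_pow_eq_pow_val, ZMod.pow_totient, Units.val_one,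
      map_one]
  have e1 : χ (p : ZMod q) = exp (arg (χ (p : ZMod q)) * I) := by
    conv_lhs => rw [← norm_mul_exp_arg_mul_I (χ (p : ZMod q)), norm_chi_eq_one χ hp hpq]
    simp
  rw [e1, ← exp_nat_mul] at h1
  obtain ⟨n, hn⟩ := exp_eq_one_iff.1 h1
  have h2 : ((q.totient * arg (χ (p : ZMod q)) : ℝ) : ℂ) = ((n * (2 * Real.pi) : ℝ) : ℂ) := by
    refine mul_right_cancel₀ I_ne_zero ?_
    push_cast
    linear_combination hn
  have h3 : q.totient * arg (χ (p : ZMod q)) = n * (2 * Real.pi) := by exact_mod_cast h2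
  refine ⟨n + q.totient * h, ?_⟩
  push_cast
  linear_combination h3

theorem pow_natAbs_eq_of_mul_log_eq {p r : ℕ} (hp : p.Prime) (hr : r.Prime) {a b : ℤ}
    (h : (a : ℝ) * Real.log r = b * Real.log p) : r ^ a.natAbs = p ^ b.natAbs := by
  have hlr : 0 < Real.log r := Real.log_pos (by exact_mod_cast hr.one_lt)
  have hlp : 0 < Real.log p := Real.log_pos (by exact_mod_cast hp.one_lt)
  have h1 : (a.natAbs : ℝ) * Real.log r = b.natAbs * Real.log p := by
    rw [Nat.cast_natAbs, Nat.cast_natAbs, Int.cast_abs, Int.cast_abs, ← abs_of_pos hlr,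
      ← abs_of_pos hlp, ← abs_mul, ← abs_mul, h]
  rw [← Real.log_pow, ← Real.log_pow] at h1
  have h2 := Real.log_injOn_pos (mem_Ioi.2 (pow_pos (by exact_mod_cast hr.pos) _))
    (mem_Ioi.2 (pow_pos (by exact_mod_cast hp.pos) _)) h1
  exact_mod_cast h2

/-- The nonzero poles of the Euler factors at distinct primes are distinct. -/
theorem eulerPole_injective {q : ℕ} [NeZero q] (χ : DirichletCharacter ℂ q) {p r : ℕ}
    (hp : p.Prime) (hpq : ¬ p ∣ q) (hr : r.Prime) (hrq : ¬ r ∣ q) {h k : ℤ}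
    (h0 : eulerPole χ p h ≠ 0) (he : eulerPole χ p h = eulerPole χ r k) : p = r ∧ h = k := by
  have hlr : 0 < Real.log r := Real.log_pos (by exact_mod_cast hr.one_lt)
  have hlp : 0 < Real.log p := Real.log_pos (by exact_mod_cast hp.one_lt)
  have hpi := Real.pi_pos
  obtain ⟨a, ha⟩ := exists_int_totient_mul_arg χ hp hpq h
  obtain ⟨b, hb⟩ := exists_int_totient_mul_arg χ hr hrq k
  have hm : (q.totient : ℝ) ≠ 0 := by
    exact_mod_cast (Nat.totient_pos.2 (NeZero.pos q)).ne'
  have he' : (arg (χ (p : ZMod q)) + 2 * Real.pi * h) / Real.log p =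
      (arg (χ (r : ZMod q)) + 2 * Real.pi * k) / Real.log r := by
    have := mul_right_cancel₀ I_ne_zero he
    exact_mod_cast this
  -- This fails only at the point `0`, where all the factors with `χ p = 1` share a pole.
  have ha0 : a ≠ 0 := by
    rintro rfl
    rw [Int.cast_zero, mul_zero, mul_eq_zero, or_iff_right hm] at ha
    exact h0 (by rw [eulerPole, ha]; simp)
  rw [div_eq_div_iff hlp.ne' hlr.ne'] at he'
  have hab : (a : ℝ) * Real.log r = b * Real.log p := by
    refine mul_left_cancel₀ (mul_pos two_pos hpi).ne' ?_
    linear_combination -Real.log r * ha + Real.log p * hb + q.totient * he'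
  have hpow := pow_natAbs_eq_of_mul_log_eq hp hr hab
  have hdvd : r ∣ p ^ b.natAbs := hpow ▸ dvd_pow_self r (Int.natAbs_ne_zero.2 ha0)
  have hrp : r = p := (Nat.prime_dvd_prime_iff_eq hr hp).1 (hr.dvd_of_dvd_pow hdvd)
  subst hrp
  refine ⟨rfl, ?_⟩
  have := mul_right_cancel₀ hlp.ne' he'
  have h2 : (h : ℝ) = k := by
    refine mul_left_cancel₀ (mul_pos two_pos hpi).ne' ?_
    linarith
  exact_mod_cast h2

/-! ### Analyticity of `ξ_u` off its poles, and its residues -/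

theorem natCast_cpow_ne_zero {p : ℕ} (hp : p.Prime) (s : ℂ) : (p : ℂ) ^ s ≠ 0 := by
  simp [cpow_eq_zero_iff, hp.ne_zero]

theorem analyticAt_const_cpow_comp {a : ℂ} (ha : a ≠ 0) {f : ℂ → ℂ} (hf : Differentiable ℂ f)
    (s : ℂ) : AnalyticAt ℂ (fun w => a ^ f w) s :=
  Differentiable.analyticAt (fun w => (hf w).const_cpow (Or.inl ha)) s

theorem analyticAt_one_sub_chi_div {q : ℕ} (χ : DirichletCharacter ℂ q) {p : ℕ}
    (hp : p.Prime) (s : ℂ) :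
    AnalyticAt ℂ (fun s : ℂ => 1 - χ (p : ZMod q) / (p : ℂ) ^ s) s :=
  analyticAt_const.sub (analyticAt_const.div (analyticAt_const_cpow_comp
    (by exact_mod_cast hp.ne_zero) differentiable_id s) (natCast_cpow_ne_zero hp s))

theorem analyticAt_prod_euler {q : ℕ} [NeZero q] (χ : DirichletCharacter ℂ q)
    {S : Finset ℕ} (hS : ∀ p ∈ S, p.Prime) {s : ℂ}
    (hs : ∀ p ∈ S, ¬ p ∣ q → ∀ h : ℤ, s ≠ eulerPole χ p h) :
    AnalyticAt ℂ (fun s : ℂ => ∏ p ∈ S, 1 / (1 - χ (p : ZMod q) / (p : ℂ) ^ s)) s := by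
  refine Finset.analyticAt_fun_prod _ fun p hp => ?_
  refine analyticAt_const.div (analyticAt_one_sub_chi_div χ (hS p hp) s) fun h0 => ?_
  by_cases hpq : p ∣ q
  · simp [chi_eq_zero χ (hS p hp) hpq] at h0
  · obtain ⟨h, hh⟩ := one_sub_chi_div_eq_zero χ (hS p hp) hpq h0
    exact hs p hp hpq h hh

theorem analyticAt_LU {q : ℕ} [NeZero q] (χ : DirichletCharacter ℂ q) {u : ℝ} {s : ℂ}
    (hs : ∀ p ∈ goodPrimes q u, ∀ h : ℤ, s ≠ eulerPole χ p h) :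
    AnalyticAt ℂ (LU χ u) s :=
  analyticAt_prod_euler χ (fun _ hp => (mem_primesUpTo.1 hp).2)
    fun p hp hpq => hs p (mem_goodPrimes.2 ⟨hp, hpq⟩)

theorem div_pi_ne_zero (q : ℕ) [NeZero q] : ((q / Real.pi : ℝ) : ℂ) ≠ 0 := by
  exact_mod_cast (div_pos (by exact_mod_cast NeZero.pos q) Real.pi_pos : (0 : ℝ) < q / Real.pi).ne'

theorem analyticAt_inv_Gamma_comp (k : ℕ) (s : ℂ) :
    AnalyticAt ℂ (fun w : ℂ => (Gamma ((w + k) / 2))⁻¹) s :=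
  Differentiable.analyticAt (differentiable_one_div_Gamma.comp
    (by fun_prop : Differentiable ℂ fun w : ℂ => (w + k) / 2)) s

theorem analyticAt_g {q : ℕ} [NeZero q] (χ : DirichletCharacter ℂ q) {s : ℂ}
    (hs : ∀ h : ℕ, s ≠ -2 * h - kappa χ) : AnalyticAt ℂ (g χ) s := by
  refine AnalyticAt.mul (analyticAt_const_cpow_comp (div_pi_ne_zero q) (by fun_prop) s) ?_
  have hG : Gamma ((s + kappa χ) / 2) ≠ 0 := Gamma_ne_zero fun m hm => hs m (by
    linear_combination 2 * hm)
  simpa using (analyticAt_inv_Gamma_comp (kappa χ) s).fun_inv (inv_ne_zero hG)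

theorem eulerPole_re {q : ℕ} (χ : DirichletCharacter ℂ q) (p : ℕ) (h : ℤ) :
    (eulerPole χ p h).re = 0 := by
  rw [eulerPole, re_ofReal_mul, I_re, mul_zero]

/-- Euler poles are purely imaginary and Gamma poles are real, so they can meet only at `0`. -/
theorem eulerPole_ne_gammaPole {q : ℕ} (χ : DirichletCharacter ℂ q) (p : ℕ) (h : ℤ) (m k : ℕ)
    (hmk : 2 * m + k ≠ 0) : eulerPole χ p h ≠ -2 * m - k := by
  intro he
  have h1 := congrArg re he
  rw [eulerPole_re] at h1
  have h2 : (-2 * (m : ℂ) - k).re = -((2 * m + k : ℕ) : ℝ) := by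
    simp
    ring
  rw [h2, eq_comm, neg_eq_zero] at h1
  exact hmk (by exact_mod_cast h1)

theorem gammaPole_eq_zero_iff (m k : ℕ) : (-2 * (m : ℂ) - k) = 0 ↔ 2 * m + k = 0 := by
  have : (-2 * (m : ℂ) - k) = -((2 * m + k : ℕ) : ℂ) := by
    push_cast
    ring
  rw [this, neg_eq_zero, Nat.cast_eq_zero]

/-- A nonzero Euler pole belongs to one factor only, so `xiUErase` is continuous there, while `1 -
χ(p) p ^ (-w)` vanishes with derivative `log p`. The pole is therefore at most simple, and the limit
is the coefficient in `eulerTerm`. -/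
theorem tendsto_mul_xiU_eulerPole {q : ℕ} [NeZero q] (χ : DirichletCharacter ℂ q) {u : ℝ} {p : ℕ}
    (hp : p ∈ goodPrimes q u) {h : ℤ} (h0 : eulerPole χ p h ≠ 0) :
    Tendsto (fun w => (w - eulerPole χ p h) * xiU χ u w) (𝓝[≠] (eulerPole χ p h))
      (𝓝 (xiUErase χ u p (eulerPole χ p h) / (Real.log p : ℂ))) := by
  set ρ := eulerPole χ p h with hρ
  obtain ⟨hpu, hpq⟩ := mem_goodPrimes.1 hp
  have hpp := prime_of_mem_goodPrimes hp
  have hlog : Real.log p ≠ 0 := (Real.log_pos (by exact_mod_cast hpp.one_lt)).ne'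
  have hlog' : ((Real.log p : ℝ) : ℂ) ≠ 0 := by exact_mod_cast hlog
  have hE : ContinuousAt (xiUErase χ u p) ρ := by
    refine ContinuousAt.mul (analyticAt_g χ fun m hm => ?_).continuousAt
      (analyticAt_prod_euler χ (fun r hr => (mem_primesUpTo.1 (Finset.mem_of_mem_erase hr)).2)
        fun r hr hrq k hk => ?_).continuousAt
    · by_cases hmk : 2 * m + kappa χ = 0
      · exact h0 (hm.trans ((gammaPole_eq_zero_iff _ _).2 hmk))
      · exact eulerPole_ne_gammaPole χ p h m _ hmk hm
    · exact (Finset.ne_of_mem_erase hr) (eulerPole_injective χ hpp hpq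
        (mem_primesUpTo.1 (Finset.mem_of_mem_erase hr)).2 hrq h0 hk).1.symm
  have hD : HasDerivAt (fun w : ℂ => 1 - χ (p : ZMod q) / (p : ℂ) ^ w) (Real.log p : ℂ) ρ := by
    have e : (fun w : ℂ => 1 - χ (p : ZMod q) / (p : ℂ) ^ w) =
        fun w => 1 - exp (-((Real.log p : ℝ) * (w - ρ))) :=
      funext fun w => by rw [chi_div_cpow_eq χ hpp hpq h]
    rw [e]
    have := ((((hasDerivAt_id ρ).sub_const ρ).const_mul ((Real.log p : ℝ) : ℂ)).neg.cexp).const_sub 1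
    simpa using this
  have hS := hD.tendsto_slope
  have h1 := (hE.tendsto.mono_left nhdsWithin_le_nhds).div hS hlog'
  refine h1.congr' ?_
  filter_upwards [self_mem_nhdsWithin] with w hw
  have hw' : w - ρ ≠ 0 := sub_ne_zero.2 hw
  have hone : 1 - χ (p : ZMod q) / (p : ℂ) ^ ρ = 0 := by
    rw [chi_div_cpow_eulerPole χ hpp hpq h, sub_self]
  simp only [Pi.div_apply]
  rw [slope_def_field, hone, sub_zero, div_div_eq_mul_div]
  have e2 : xiU χ u w = xiUErase χ u p w * (1 / (1 - χ (p : ZMod q) / (p : ℂ) ^ w)) := by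
    rw [xiU, LU, xiUErase, ← Finset.mul_prod_erase _ _ hpu]
    ring
  rw [e2]
  ring

/-- The residue at `-n` moves one step to the left through `Γ(z) = Γ(z + 1) / z`. -/
theorem tendsto_add_nat_mul_Gamma (n : ℕ) :
    Tendsto (fun z : ℂ => (z + n) * Gamma z) (𝓝[≠] (-n : ℂ)) (𝓝 ((-1) ^ n / Gamma (n + 1))) := by
  induction n with
  | zero => simpa using tendsto_self_mul_Gamma_nhds_zero
  | succ n ih =>
    have hn1 : ((n : ℂ) + 1) ≠ 0 := by exact_mod_cast n.succ_ne_zero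
    have hshift : Tendsto (fun z : ℂ => z + 1) (𝓝[≠] (-(n + 1 : ℕ) : ℂ)) (𝓝[≠] (-n : ℂ)) := by
      refine tendsto_nhdsWithin_of_tendsto_nhds_of_eventually_within _ ?_ ?_
      · have : Tendsto (fun z : ℂ => z + 1) (𝓝 (-(n + 1 : ℕ) : ℂ)) (𝓝 (-(n + 1 : ℕ) + 1)) :=
          (continuous_id.add continuous_const).tendsto _
        refine (this.mono_left nhdsWithin_le_nhds).trans_eq ?_
        push_cast
        ring_nf
      · filter_upwards [self_mem_nhdsWithin] with z hz h
        refine hz ?_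
        simp only [mem_singleton_iff] at h ⊢
        push_cast
        linear_combination h
    have hid : Tendsto (fun z : ℂ => z) (𝓝[≠] (-(n + 1 : ℕ) : ℂ)) (𝓝 (-(n + 1 : ℕ) : ℂ)) :=
      tendsto_id.mono_left nhdsWithin_le_nhds
    have hne : (-(n + 1 : ℕ) : ℂ) ≠ 0 := by
      push_cast
      exact neg_ne_zero.2 hn1
    have h1 := (ih.comp hshift).div hid hne
    have hG : Gamma ((n : ℂ) + 1) ≠ 0 := by
      rw [Gamma_nat_eq_factorial]
      exact_mod_cast n.factorial_ne_zero
    have e : (-1) ^ n / Gamma (n + 1) / (-(n + 1 : ℕ) : ℂ) =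
        (-1) ^ (n + 1) / Gamma ((n + 1 : ℕ) + 1) := by
      push_cast
      rw [Gamma_add_one _ hn1, pow_succ]
      field_simp
    rw [e] at h1
    refine h1.congr' ?_
    filter_upwards [hid.eventually (isOpen_ne.mem_nhds hne)] with z hz
    simp only [Pi.div_apply, Function.comp]
    rw [Gamma_add_one z hz]
    push_cast
    field_simp
    ring

/-- The factor `2` comes from `w - ρ = 2 * ((w + κ) / 2 + h)`; the other factors of `ξ_u` are
continuous at `ρ`. -/
theorem tendsto_mul_xiU_gammaPole {q : ℕ} [NeZero q] (χ : DirichletCharacter ℂ q) (u : ℝ) {h : ℕ}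
    (h0 : 2 * h + kappa χ ≠ 0) :
    Tendsto (fun w => (w - (-2 * h - kappa χ)) * xiU χ u w) (𝓝[≠] (-2 * h - kappa χ : ℂ))
      (𝓝 (2 * (-1) ^ h * (Real.pi : ℂ) ^ h * LU χ u (-2 * h - kappa χ) /
        ((q : ℂ) ^ h * Gamma (h + 1)))) := by
  set ρ : ℂ := -2 * h - kappa χ with hρ
  have hq0 : (q : ℂ) ≠ 0 := by exact_mod_cast NeZero.ne q
  have hpi : (Real.pi : ℂ) ≠ 0 := by exact_mod_cast Real.pi_ne_zero
  have hq : (0 : ℝ) < q / Real.pi := div_pos (by exact_mod_cast NeZero.pos q) Real.pi_pos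
  have hq' : (((q / Real.pi : ℝ)) : ℂ) ≠ 0 := by exact_mod_cast hq.ne'
  have hLU : ContinuousAt (LU χ u) ρ :=
    (analyticAt_LU χ fun p _ k hk => eulerPole_ne_gammaPole χ p k h _ h0 hk.symm).continuousAt
  have hz : Tendsto (fun w : ℂ => (w + kappa χ) / 2) (𝓝[≠] ρ) (𝓝[≠] (-h : ℂ)) := by
    refine tendsto_nhdsWithin_of_tendsto_nhds_of_eventually_within _ ?_ ?_
    · have : Tendsto (fun w : ℂ => (w + kappa χ) / 2) (𝓝 ρ) (𝓝 ((ρ + kappa χ) / 2)) :=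
        (by fun_prop : Continuous fun w : ℂ => (w + kappa χ) / 2).tendsto _
      refine (this.mono_left nhdsWithin_le_nhds).trans_eq ?_
      rw [hρ]
      congr 1
      ring
    · filter_upwards [self_mem_nhdsWithin] with w hw hc
      refine hw ?_
      simp only [mem_singleton_iff] at hc ⊢
      rw [hρ]
      linear_combination 2 * hc
  have hG := (tendsto_add_nat_mul_Gamma h).comp hz
  have hK : Tendsto (fun w : ℂ => ((q / Real.pi : ℝ) : ℂ) ^ ((w + kappa χ) / 2)) (𝓝[≠] ρ)
      (𝓝 (((q / Real.pi : ℝ) : ℂ) ^ ((ρ + kappa χ) / 2))) :=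
    ((DifferentiableAt.const_cpow (by fun_prop) (Or.inl hq')).continuousAt.tendsto).mono_left
      nhdsWithin_le_nhds
  have hall := ((hG.const_mul 2).mul hK).mul (hLU.tendsto.mono_left nhdsWithin_le_nhds)
  have e1 : ((q / Real.pi : ℝ) : ℂ) ^ ((ρ + kappa χ) / 2) = (Real.pi : ℂ) ^ h / (q : ℂ) ^ h := by
    have : (ρ + kappa χ) / 2 = -(h : ℂ) := by
      rw [hρ]
      ring
    rw [this, cpow_neg, cpow_natCast]
    push_cast
    rw [div_pow, inv_div]
  rw [e1] at hall
  have e2 : 2 * ((-1) ^ h / Gamma (h + 1)) * ((Real.pi : ℂ) ^ h / (q : ℂ) ^ h) * LU χ u ρ =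
      2 * (-1) ^ h * (Real.pi : ℂ) ^ h * LU χ u ρ / ((q : ℂ) ^ h * Gamma (h + 1)) := by
    rw [mul_comm ((q : ℂ) ^ h), ← div_div]
    ring
  rw [e2] at hall
  refine hall.congr fun w => ?_
  simp only [Function.comp, xiU, g, hρ]
  ring

/-- Used at `0`, where poles of the Gamma factor and of several Euler factors may pile up to a pole
of higher order. The reciprocals of all these factors are entire. -/
theorem meromorphicAt_xiU {q : ℕ} [NeZero q] (χ : DirichletCharacter ℂ q) (u : ℝ) (s : ℂ) :
    MeromorphicAt (xiU χ u) s := by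
  have h3 : MeromorphicAt (fun w : ℂ => Gamma ((w + kappa χ) / 2)) s := by
    simpa using (analyticAt_inv_Gamma_comp (kappa χ) s).meromorphicAt.fun_inv
  have h4 : MeromorphicAt (LU χ u) s := by
    refine MeromorphicAt.fun_prod fun p hp => ?_
    simpa using
      (analyticAt_one_sub_chi_div χ (mem_primesUpTo.1 hp).2 s).meromorphicAt.fun_inv
  exact ((analyticAt_const_cpow_comp (div_pi_ne_zero q) (by fun_prop) s).meromorphicAt.mul h3).mul h4

theorem analyticAt_xiU {q : ℕ} [NeZero q] (χ : DirichletCharacter ℂ q) {u : ℝ} {s : ℂ}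
    (h1 : ∀ p ∈ goodPrimes q u, ∀ h : ℤ, s ≠ eulerPole χ p h)
    (h2 : ∀ h : ℕ, s ≠ -2 * h - kappa χ) : AnalyticAt ℂ (xiU χ u) s :=
  (analyticAt_g χ h2).mul (analyticAt_LU χ h1)

/-! ### Principal parts and Cauchy's formula -/

/-- All poles of the integrand lie inside the circle and it decays at least like `z ^ (-2)`, so the
residues cancel. This is why principal parts drop out of Cauchy's formula for a point inside the
circle. -/
theorem circleIntegral_inv_pow_mul_inv_eq_zero {T : ℝ} {ρ s : ℂ} (hρ : ρ ∈ ball (0 : ℂ) T)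
    (hs : s ∈ ball (0 : ℂ) T) (k : ℕ) :
    ∮ z in C(0, T), (z - s)⁻¹ * ((z - ρ) ^ (k + 1))⁻¹ = 0 := by
  have hT : 0 < T := pos_of_mem_ball hs
  have hne : ∀ {w : ℂ}, w ∈ ball (0 : ℂ) T → ∀ z ∈ sphere (0 : ℂ) T, z - w ≠ 0 := by
    intro w hw z hz h0
    rw [sub_eq_zero.1 h0] at hz
    exact (mem_ball.1 hw).ne (mem_sphere.1 hz)
  rcases eq_or_ne ρ s with rfl | hρs
  · have e : ∀ z : ℂ, (z - ρ)⁻¹ * ((z - ρ) ^ (k + 1))⁻¹ = (z - ρ) ^ (-(k + 2 : ℕ) : ℤ) := fun z => by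
      rw [zpow_neg, zpow_natCast, ← mul_inv, ← pow_succ']
    simp_rw [e]
    exact circleIntegral.integral_sub_zpow_of_ne (by omega) _ _ _
  have hρs' : ρ - s ≠ 0 := sub_ne_zero.2 hρs
  have hI : ∀ {w : ℂ}, w ∈ ball (0 : ℂ) T → ∀ j : ℕ,
      CircleIntegrable (fun z => ((z - w) ^ j)⁻¹) 0 T := fun hw j =>
    ContinuousOn.circleIntegrable hT.le (ContinuousOn.inv₀ (by fun_prop)
      fun z hz => pow_ne_zero _ (hne hw z hz))
  have hI2 : ∀ j : ℕ, CircleIntegrable (fun z => (z - s)⁻¹ * ((z - ρ) ^ j)⁻¹) 0 T := fun j =>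
    ContinuousOn.circleIntegrable hT.le (ContinuousOn.mul
      (ContinuousOn.inv₀ (by fun_prop) (hne hs))
      (ContinuousOn.inv₀ (by fun_prop) fun z hz => pow_ne_zero _ (hne hρ z hz)))
  -- Partial fractions: `(ρ - s) / ((z - s) (z - ρ)) = 1 / (z - ρ) - 1 / (z - s)`.
  have step : ∀ j : ℕ, (∮ z in C(0, T), (z - s)⁻¹ * ((z - ρ) ^ (j + 1))⁻¹) =
      (ρ - s)⁻¹ * ((∮ z in C(0, T), ((z - ρ) ^ (j + 1))⁻¹) -
        ∮ z in C(0, T), (z - s)⁻¹ * ((z - ρ) ^ j)⁻¹) := by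
    intro j
    rw [← circleIntegral.integral_sub (hI hρ _) (hI2 _), ← circleIntegral.integral_const_mul]
    refine circleIntegral.integral_congr hT.le fun z hz => ?_
    have h1 := hne hs z hz
    have h2 := hne hρ z hz
    field_simp
    ring
  have hinv : ∀ {w : ℂ}, w ∈ ball (0 : ℂ) T → ∮ z in C(0, T), (z - w)⁻¹ = 2 * Real.pi * I :=
    fun hw => circleIntegral.integral_sub_inv_of_mem_ball hw
  induction k with
  | zero =>
    rw [step]
    simp only [zero_add, pow_one, pow_zero, inv_one, mul_one]
    rw [hinv hs, hinv hρ, sub_self, mul_zero]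
  | succ k ih =>
    rw [step, ih, sub_zero]
    have e : ∀ z : ℂ, ((z - ρ) ^ (k + 1 + 1))⁻¹ = (z - ρ) ^ (-(k + 2 : ℕ) : ℤ) := fun z => by
      rw [zpow_neg, zpow_natCast]
    simp_rw [e]
    rw [circleIntegral.integral_sub_zpow_of_ne (by omega), mul_zero]

theorem AnalyticAt.dslope_self {f : ℂ → ℂ} {c : ℂ} (hf : AnalyticAt ℂ f c) :
    AnalyticAt ℂ (dslope f c) c := by
  obtain ⟨p, hp⟩ := hf
  exact ⟨_, hp.has_fpower_series_dslope_fslope⟩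

/-- A function with a simple pole is its principal part plus an analytic function. -/
theorem exists_analyticAt_of_simple_pole {f : ℂ → ℂ} {ρ a : ℂ}
    (hf : ∀ᶠ w in 𝓝[≠] ρ, DifferentiableAt ℂ f w)
    (ha : Tendsto (fun w => (w - ρ) * f w) (𝓝[≠] ρ) (𝓝 a)) :
    ∃ G : ℂ → ℂ, AnalyticAt ℂ G ρ ∧ ∀ᶠ w in 𝓝[≠] ρ, f w = a / (w - ρ) + G w := by
  set k := Function.update (fun w => (w - ρ) * f w) ρ a with hk
  have hkne : ∀ w, w ≠ ρ → k w = (w - ρ) * f w := fun w hw => Function.update_of_ne hw _ _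
  have hkρ : k ρ = a := Function.update_self _ _ _
  have hka : AnalyticAt ℂ k ρ := by
    refine analyticAt_of_differentiable_on_punctured_nhds_of_continuousAt ?_
      (continuousAt_update_same.2 ha)
    filter_upwards [hf, self_mem_nhdsWithin] with w hw hwρ
    have hd : DifferentiableAt ℂ (fun w => (w - ρ) * f w) w := (by fun_prop : DifferentiableAt ℂ
      (fun w => w - ρ) w).mul hw
    exact hd.congr_of_eventuallyEq ((eventually_ne_nhds hwρ).mono hkne)
  refine ⟨dslope k ρ, AnalyticAt.dslope_self hka, ?_⟩
  filter_upwards [self_mem_nhdsWithin] with w hw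
  have hw' : w - ρ ≠ 0 := sub_ne_zero.2 hw
  rw [dslope_of_ne _ hw, slope_def_field, hkρ, hkne w hw]
  field_simp
  ring

/-- Taylor coefficients are peeled off one at a time: `h z = h 0 + z * dslope h 0 z`, and the
quotient is again analytic. -/
theorem exists_polar_part_div_pow (m : ℕ) {h : ℂ → ℂ} (hh : AnalyticAt ℂ h 0) :
    ∃ (d : ℕ → ℂ) (G : ℂ → ℂ), AnalyticAt ℂ G 0 ∧
      ∀ᶠ z in 𝓝[≠] (0 : ℂ), h z / z ^ m = ∑ k ∈ Finset.range m, d k / z ^ (k + 1) + G z := by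
  induction m generalizing h with
  | zero => exact ⟨0, h, hh, by simp⟩
  | succ m ih =>
    obtain ⟨d, G, hG, hd⟩ := ih (AnalyticAt.dslope_self hh)
    refine ⟨Function.update d m (h 0), G, hG, ?_⟩
    filter_upwards [hd, self_mem_nhdsWithin] with z hz hz0
    have hz0' : z ≠ 0 := hz0
    rw [dslope_of_ne _ hz0', slope_def_field, sub_zero] at hz
    rw [Finset.sum_range_succ, Function.update_self,
      Finset.sum_congr rfl fun k hk => by
        rw [Function.update_of_ne (Finset.mem_range.1 hk).ne]]
    have : h z / z ^ (m + 1) = (h z - h 0) / z / z ^ m + h 0 / z ^ (m + 1) := by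
      field_simp
      ring
    rw [this, hz]
    ring

/-- A meromorphic function near `0` is a finite polar part plus an analytic function. -/
theorem exists_polar_part {f : ℂ → ℂ} (hf : MeromorphicAt f 0) :
    ∃ (m : ℕ) (d : ℕ → ℂ) (G : ℂ → ℂ), AnalyticAt ℂ G 0 ∧
      ∀ᶠ z in 𝓝[≠] (0 : ℂ), f z = ∑ k ∈ Finset.range m, d k / z ^ (k + 1) + G z := by
  obtain ⟨m, hm⟩ := hf
  obtain ⟨d, G, hG, hd⟩ := exists_polar_part_div_pow m hm
  refine ⟨m, d, G, hG, ?_⟩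
  filter_upwards [hd, self_mem_nhdsWithin] with z hz hz0
  have hz0' : z ≠ 0 := hz0
  rw [← hz, sub_zero, smul_eq_mul, mul_div_cancel_left₀ _ (pow_ne_zero _ hz0')]

/-- On a small circle only the `z ^ (-1)` term of `z ^ k * f z` contributes to the integral, so the
limit is of an eventually constant function. -/
theorem polarCoeff_eq {f G : ℂ → ℂ} {m : ℕ} {d : ℕ → ℂ} (hG : AnalyticAt ℂ G 0)
    (hf : ∀ᶠ z in 𝓝[≠] (0 : ℂ), f z = ∑ k ∈ Finset.range m, d k / z ^ (k + 1) + G z) (k : ℕ) :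
    polarCoeff f k = if k < m then d k else 0 := by
  refine Tendsto.limUnder_eq (tendsto_const_nhds.congr' ?_)
  have h1 : ∀ᶠ z in 𝓝 (0 : ℂ), z ≠ 0 → f z = ∑ k ∈ Finset.range m, d k / z ^ (k + 1) + G z :=
    eventually_nhdsWithin_iff.1 hf
  obtain ⟨ε, hε, hball⟩ := Metric.eventually_nhds_iff_ball.1 (h1.and hG.eventually_analyticAt)
  filter_upwards [Ioo_mem_nhdsGT hε] with r hr
  have hr0 : 0 < r := hr.1
  have hsub : closedBall (0 : ℂ) r ⊆ ball 0 ε := closedBall_subset_ball hr.2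
  have hne : ∀ z ∈ sphere (0 : ℂ) r, z ≠ 0 := fun z hz h0 => by
    rw [h0, mem_sphere, dist_self] at hz
    exact hr0.ne hz
  have e1 : (∮ z in C(0, r), z ^ k * f z) =
      ∮ z in C(0, r), (∑ j ∈ Finset.range m, d j * (z - 0) ^ ((k : ℤ) - (j + 1 : ℕ))) +
        z ^ k * G z := by
    refine circleIntegral.integral_congr hr0.le fun z hz => ?_
    have hz0 := hne z hz
    rw [(hball z (hsub (sphere_subset_closedBall hz))).1 hz0, mul_add, Finset.mul_sum]
    congr 1
    refine Finset.sum_congr rfl fun j _ => ?_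
    rw [sub_zero, zpow_sub₀ hz0, zpow_natCast, zpow_natCast]
    ring
  have hGc : ContinuousOn G (closedBall 0 r) := fun z hz =>
    (hball z (hsub hz)).2.continuousAt.continuousWithinAt
  have hzp : ∀ j : ℕ, ContinuousOn (fun z : ℂ => d j * (z - 0) ^ ((k : ℤ) - (j + 1 : ℕ)))
      (sphere 0 r) := fun j => continuousOn_const.mul (ContinuousOn.zpow₀ (by fun_prop) _
        fun z hz => Or.inl (by rw [sub_zero]; exact hne z hz))
  have i1 : CircleIntegrable
      (fun z => ∑ j ∈ Finset.range m, d j * (z - 0) ^ ((k : ℤ) - (j + 1 : ℕ))) 0 r :=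
    ContinuousOn.circleIntegrable hr0.le (continuousOn_finsetSum _ fun j _ => hzp j)
  have i2 : CircleIntegrable (fun z => z ^ k * G z) 0 r :=
    ContinuousOn.circleIntegrable hr0.le ((by fun_prop : ContinuousOn (fun z : ℂ => z ^ k)
      (sphere 0 r)).mul (hGc.mono sphere_subset_closedBall))
  rw [e1, circleIntegral.integral_add i1 i2,
    circleIntegral.integral_fun_sum fun j _ => ContinuousOn.circleIntegrable hr0.le (hzp j)]
  have e2 : ∮ z in C(0, r), z ^ k * G z = 0 := by
    refine DiffContOnCl.circleIntegral_eq_zero hr0.le (DifferentiableOn.diffContOnCl ?_)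
    rw [closure_ball _ hr0.ne']
    exact fun z hz => ((differentiableAt_id.pow k).mul
      (hball z (hsub hz)).2.differentiableAt).differentiableWithinAt
  have e3 : ∀ j : ℕ, (∮ z in C(0, r), d j * (z - 0) ^ ((k : ℤ) - (j + 1 : ℕ))) =
      if j = k then d j * (2 * Real.pi * I) else 0 := by
    intro j
    rw [circleIntegral.integral_const_mul]
    split_ifs with hjk
    · subst hjk
      have : ((j : ℤ) - (j + 1 : ℕ)) = -1 := by push_cast; ring
      simp_rw [this, zpow_neg_one]
      rw [circleIntegral.integral_sub_center_inv _ hr0.ne']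
    · rw [circleIntegral.integral_sub_zpow_of_ne (by omega), mul_zero]
  simp_rw [e3]
  rw [e2, add_zero, Finset.sum_ite_eq' (Finset.range m) k fun j => d j * (2 * Real.pi * I)]
  simp only [Finset.mem_range]
  split_ifs
  · have := two_pi_I_ne_zero
    field_simp
  · simp

theorem principalPartAtZero_eq {f G : ℂ → ℂ} {m : ℕ} {d : ℕ → ℂ} (hG : AnalyticAt ℂ G 0)
    (hf : ∀ᶠ z in 𝓝[≠] (0 : ℂ), f z = ∑ k ∈ Finset.range m, d k / z ^ (k + 1) + G z) (s : ℂ) :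
    principalPartAtZero f s = ∑ k ∈ Finset.range m, d k / s ^ (k + 1) := by
  rw [principalPartAtZero, tsum_eq_sum (s := Finset.range m)]
  · refine Finset.sum_congr rfl fun k hk => ?_
    rw [polarCoeff_eq hG hf, if_pos (Finset.mem_range.1 hk)]
  · intro k hk
    rw [polarCoeff_eq hG hf, if_neg (by simpa using hk), zero_div]

/-- Taking the punctured limit at every point fills all removable singularities at once. Near `w`
the result coincides with the analytic germ `G`. -/
theorem analyticAt_limUnder {H G : ℂ → ℂ} {w : ℂ} (hG : AnalyticAt ℂ G w)
    (h : ∀ᶠ z in 𝓝[≠] w, H z = G z) :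
    AnalyticAt ℂ (fun z => limUnder (𝓝[≠] z) H) w ∧
      Tendsto H (𝓝[≠] w) (𝓝 (limUnder (𝓝[≠] w) H)) := by
  have hlim : ∀ {z : ℂ}, AnalyticAt ℂ G z → (∀ᶠ y in 𝓝[≠] z, H y = G y) →
      Tendsto H (𝓝[≠] z) (𝓝 (G z)) := fun hz hy =>
    (hz.continuousAt.tendsto.mono_left nhdsWithin_le_nhds).congr' (hy.mono fun _ h => h.symm)
  refine ⟨hG.congr ?_, (hlim hG h).limUnder_eq.symm ▸ hlim hG h⟩
  have h1 := eventually_nhdsWithin_iff.1 h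
  filter_upwards [hG.eventually_analyticAt, h1.eventually_nhds] with z hz h2
  refine (hlim hz ?_).limUnder_eq.symm
  rcases eq_or_ne z w with rfl | hzw
  · exact h
  · refine mem_nhdsWithin_of_mem_nhds ?_
    filter_upwards [h2, eventually_ne_nhds hzw] with y hy hyw using hy hyw

/-- A function which is small on a circle differs little, inside, from the sum of its principal
parts in the disk. -/
theorem exists_tendsto_sub_principal_parts {T ε : ℝ} (Z : Finset ℂ) (a : ℂ → ℂ) (m : ℕ)
    (d : ℕ → ℂ) {f G : ℂ → ℂ} (hZ : ∀ ρ ∈ Z, ρ ≠ 0 ∧ ‖ρ‖ < T)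
    (hf : ∀ w, ‖w‖ ≤ T → w ∉ Z → w ≠ 0 → AnalyticAt ℂ f w)
    (hres : ∀ ρ ∈ Z, Tendsto (fun w => (w - ρ) * f w) (𝓝[≠] ρ) (𝓝 (a ρ)))
    (hG : AnalyticAt ℂ G 0)
    (h0 : ∀ᶠ z in 𝓝[≠] (0 : ℂ), f z = ∑ k ∈ Finset.range m, d k / z ^ (k + 1) + G z)
    (hb : ∀ w, ‖w‖ = T → ‖f w‖ ≤ ε) {s : ℂ} (hs : ‖s‖ < T) :
    ∃ e : ℂ, ‖e‖ ≤ ε * T / (T - ‖s‖) ∧ Tendsto (fun w => f w - (∑ ρ ∈ Z, a ρ / (w - ρ) +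
      ∑ k ∈ Finset.range m, d k / w ^ (k + 1))) (𝓝[≠] s) (𝓝 e) := by
  have hT : 0 < T := (norm_nonneg s).trans_lt hs
  set H : ℂ → ℂ := fun w => f w - (∑ ρ ∈ Z, a ρ / (w - ρ) +
      ∑ k ∈ Finset.range m, d k / w ^ (k + 1)) with hH
  have aZ : ∀ (S : Finset ℂ) (w : ℂ), w ∉ S →
      AnalyticAt ℂ (fun w => ∑ ρ ∈ S, a ρ / (w - ρ)) w := fun S w hw =>
    Finset.analyticAt_fun_sum _ fun ρ hρ => analyticAt_const.div
      (analyticAt_id.sub analyticAt_const) (sub_ne_zero.2 fun h => hw (h ▸ hρ))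
  have a0 : ∀ w : ℂ, w ≠ 0 →
      AnalyticAt ℂ (fun w => ∑ k ∈ Finset.range m, d k / w ^ (k + 1)) w := fun w hw =>
    Finset.analyticAt_fun_sum _ fun k _ => analyticAt_const.div
      (analyticAt_id.pow _) (pow_ne_zero _ hw)
  have hHa : ∀ w, ‖w‖ ≤ T → w ∉ Z → w ≠ 0 → AnalyticAt ℂ H w := fun w hw hwZ hw0 =>
    (hf w hw hwZ hw0).sub ((aZ Z w hwZ).add (a0 w hw0))
  -- The singularities of `H` in the disk are removable: at `0` and at the points of `Z` the
  -- corresponding principal part has been subtracted.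
  have hrem : ∀ w ∈ closedBall (0 : ℂ) T, ∃ K : ℂ → ℂ, AnalyticAt ℂ K w ∧
      ∀ᶠ z in 𝓝[≠] w, H z = K z := by
    intro w hw
    rw [mem_closedBall, dist_zero_right] at hw
    rcases eq_or_ne w 0 with rfl | hw0
    · refine ⟨fun z => G z - ∑ ρ ∈ Z, a ρ / (z - ρ), hG.sub (aZ Z 0 fun h => (hZ 0 h).1 rfl), ?_⟩
      filter_upwards [h0] with z hz
      simp only [hH, hz]
      ring
    by_cases hwZ : w ∈ Z
    · have hev : ∀ᶠ z in 𝓝[≠] w, DifferentiableAt ℂ f z := by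
        have h1 : ∀ᶠ z in 𝓝 w, ‖z‖ < T :=
          (continuous_norm.continuousAt.tendsto).eventually (gt_mem_nhds (hZ w hwZ).2)
        have h2 : ∀ᶠ z in 𝓝 w, z ∉ (Z.erase w : Set ℂ) :=
          (Z.erase w).finite_toSet.isClosed.isOpen_compl.mem_nhds (by simp)
        filter_upwards [mem_nhdsWithin_of_mem_nhds h1, mem_nhdsWithin_of_mem_nhds h2,
          mem_nhdsWithin_of_mem_nhds (eventually_ne_nhds hw0), self_mem_nhdsWithin]
          with z hz1 hz2 hz3 hz4
        exact (hf z (le_of_lt hz1) (fun h => hz2 (by simpa [h] using hz4)) hz3).differentiableAt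
      obtain ⟨K, hK, hKe⟩ := exists_analyticAt_of_simple_pole hev (hres w hwZ)
      refine ⟨fun z => K z - (∑ ρ ∈ Z.erase w, a ρ / (z - ρ) +
        ∑ k ∈ Finset.range m, d k / z ^ (k + 1)),
        hK.sub ((aZ _ w (Finset.notMem_erase w Z)).add (a0 w hw0)), ?_⟩
      filter_upwards [hKe] with z hz
      simp only [hH, hz]
      rw [← Finset.add_sum_erase Z _ hwZ]
      ring
    · exact ⟨H, hHa w hw hwZ hw0, Eventually.of_forall fun _ => rfl⟩
  set E : ℂ → ℂ := fun z => limUnder (𝓝[≠] z) H with hE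
  have hEa : ∀ w ∈ closedBall (0 : ℂ) T, AnalyticAt ℂ E w ∧ Tendsto H (𝓝[≠] w) (𝓝 (E w)) := by
    intro w hw
    obtain ⟨K, hK, hKe⟩ := hrem w hw
    exact analyticAt_limUnder hK hKe
  have hsb : s ∈ ball (0 : ℂ) T := by simpa using hs
  refine ⟨E s, ?_, (hEa s (ball_subset_closedBall hsb)).2⟩
  have hsph : ∀ z ∈ sphere (0 : ℂ) T, z ∉ Z ∧ z ≠ 0 ∧ ‖z‖ = T := by
    intro z hz
    rw [mem_sphere, dist_zero_right] at hz
    exact ⟨fun h => (hZ z h).2.ne hz, norm_pos_iff.1 (hz ▸ hT), hz⟩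
  have hEH : ∀ z ∈ sphere (0 : ℂ) T, E z = H z := fun z hz =>
    ((hHa z (hsph z hz).2.2.le (hsph z hz).1 (hsph z hz).2.1).continuousAt.tendsto.mono_left
      nhdsWithin_le_nhds).limUnder_eq
  have hcauchy : ∮ z in C(0, T), (z - s)⁻¹ • E z = (2 * Real.pi * I : ℂ) • E s := by
    refine DiffContOnCl.circleIntegral_sub_inv_smul (DifferentiableOn.diffContOnCl ?_) hsb
    rw [closure_ball _ hT.ne']
    exact fun z hz => (hEa z hz).1.differentiableAt.differentiableWithinAt
  have hcs : ContinuousOn (fun z : ℂ => (z - s)⁻¹) (sphere 0 T) := by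
    refine ContinuousOn.inv₀ (by fun_prop) fun z hz h => ?_
    rw [sub_eq_zero.1 h] at hz
    exact (mem_ball.1 hsb).ne (mem_sphere.1 hz)
  have hfc : ContinuousOn f (sphere 0 T) := fun z hz =>
    (hf z (hsph z hz).2.2.le (hsph z hz).1 (hsph z hz).2.1).continuousAt.continuousWithinAt
  have hpc : ∀ (c ρ : ℂ) (k : ℕ), ρ ∈ ball (0 : ℂ) T → CircleIntegrable
      (fun z => c * ((z - s)⁻¹ * ((z - ρ) ^ (k + 1))⁻¹)) 0 T := by
    intro c ρ k hρ
    refine ContinuousOn.circleIntegrable hT.le (continuousOn_const.mul (hcs.mul ?_))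
    refine ContinuousOn.inv₀ (by fun_prop) fun z hz h => ?_
    rw [sub_eq_zero.1 (eq_zero_of_pow_eq_zero h)] at hz
    exact (mem_ball.1 hρ).ne (mem_sphere.1 hz)
  have hZb : ∀ ρ ∈ Z, ρ ∈ ball (0 : ℂ) T := fun ρ hρ => by simpa using (hZ ρ hρ).2
  have h0b : (0 : ℂ) ∈ ball (0 : ℂ) T := mem_ball_self hT
  -- The principal parts integrate to `0`, so `E s` is the Cauchy integral of `f` alone, and `f` is
  -- small on the circle.
  have hint : ∮ z in C(0, T), (z - s)⁻¹ • E z = ∮ z in C(0, T), (z - s)⁻¹ * f z := by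
    have e1 : ∮ z in C(0, T), (z - s)⁻¹ • E z = ∮ z in C(0, T), ((z - s)⁻¹ * f z -
        ∑ ρ ∈ Z, a ρ * ((z - s)⁻¹ * ((z - ρ) ^ (0 + 1))⁻¹)) -
        ∑ k ∈ Finset.range m, d k * ((z - s)⁻¹ * ((z - 0) ^ (k + 1))⁻¹) := by
      refine circleIntegral.integral_congr hT.le fun z hz => ?_
      simp only [hEH z hz, hH, smul_eq_mul, zero_add, pow_one, sub_zero, mul_sub, mul_add,
        Finset.mul_sum, div_eq_mul_inv, mul_left_comm (z - s)⁻¹]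
      ring
    have i1 : CircleIntegrable (fun z => (z - s)⁻¹ * f z) 0 T :=
      (hcs.mul hfc).circleIntegrable hT.le
    have i2 : CircleIntegrable
        (fun z => ∑ ρ ∈ Z, a ρ * ((z - s)⁻¹ * ((z - ρ) ^ (0 + 1))⁻¹)) 0 T := by
      simpa [Finset.sum_fn] using CircleIntegrable.sum Z fun ρ hρ => hpc (a ρ) ρ 0 (hZb ρ hρ)
    have i3 : CircleIntegrable
        (fun z => ∑ k ∈ Finset.range m, d k * ((z - s)⁻¹ * ((z - 0) ^ (k + 1))⁻¹)) 0 T := by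
      simpa [Finset.sum_fn] using
        CircleIntegrable.sum (Finset.range m) fun k _ => hpc (d k) 0 k h0b
    have i12 : CircleIntegrable (fun z => (z - s)⁻¹ * f z -
        ∑ ρ ∈ Z, a ρ * ((z - s)⁻¹ * ((z - ρ) ^ (0 + 1))⁻¹)) 0 T := i1.sub i2
    rw [e1, circleIntegral.integral_sub i12 i3, circleIntegral.integral_sub i1 i2,
      circleIntegral.integral_fun_sum fun ρ hρ => hpc (a ρ) ρ 0 (hZb ρ hρ),
      circleIntegral.integral_fun_sum fun k _ => hpc (d k) 0 k h0b,
      Finset.sum_eq_zero fun ρ hρ => ?_, Finset.sum_eq_zero fun k _ => ?_, sub_zero, sub_zero]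
    · rw [circleIntegral.integral_const_mul,
        circleIntegral_inv_pow_mul_inv_eq_zero h0b hsb k, mul_zero]
    · rw [circleIntegral.integral_const_mul,
        circleIntegral_inv_pow_mul_inv_eq_zero (hZb ρ hρ) hsb 0, mul_zero]
  have hds : 0 < T - ‖s‖ := sub_pos.2 hs
  have hbound : ‖∮ z in C(0, T), (z - s)⁻¹ * f z‖ ≤ 2 * Real.pi * T * ((T - ‖s‖)⁻¹ * ε) := by
    refine circleIntegral.norm_integral_le_of_norm_le_const hT.le fun z hz => ?_
    rw [norm_mul, norm_inv]
    refine mul_le_mul (inv_anti₀ hds ?_) (hb z (hsph z hz).2.2) (norm_nonneg _)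
      (inv_nonneg.2 hds.le)
    have := norm_sub_norm_le z s
    rwa [(hsph z hz).2.2] at this
  rw [← hint, hcauchy, norm_smul] at hbound
  have h2pi : ‖(2 * Real.pi * I : ℂ)‖ = 2 * Real.pi := by simp [Real.pi_pos.le]
  rw [h2pi, mul_assoc (2 * Real.pi)] at hbound
  have := le_of_mul_le_mul_left hbound (by positivity)
  refine this.trans (le_of_eq ?_)
  field_simp

/-! ### The difference of `ξ_u` and its tail -/

/-- `χ` restricted to the integers all of whose prime factors are at most `u`. -/
noncomputable def smoothCoeff {q : ℕ} (χ : DirichletCharacter ℂ q) (u : ℝ) : ℕ → ℂ :=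
  (Nat.smoothNumbers (⌊u⌋₊ + 1)).indicator fun n => χ (n : ZMod q)

theorem norm_smoothCoeff_le {q : ℕ} (χ : DirichletCharacter ℂ q) (u : ℝ) (n : ℕ) :
    ‖smoothCoeff χ u n‖ ≤ 1 :=
  (norm_indicator_le_norm_self _ _).trans (χ.norm_le_one _)

theorem smoothCoeff_zero {q : ℕ} (χ : DirichletCharacter ℂ q) (u : ℝ) : smoothCoeff χ u 0 = 0 :=
  indicator_of_notMem (fun h => Nat.ne_zero_of_mem_smoothNumbers h rfl) _

/-- The part over `x > 1` of the Mellin integral that represents `ξ_u`. -/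
noncomputable def smoothTail {q : ℕ} (χ : DirichletCharacter ℂ q) (u : ℝ) : ℂ → ℂ :=
  thetaTail (smoothCoeff χ u) (kappa χ) (Real.pi / q)

theorem pi_div_pos (q : ℕ) [NeZero q] : 0 < Real.pi / q :=
  div_pos Real.pi_pos (by exact_mod_cast NeZero.pos q)

theorem differentiable_smoothTail {q : ℕ} [NeZero q] (χ : DirichletCharacter ℂ q) (u : ℝ) :
    Differentiable ℂ (smoothTail χ u) :=
  differentiable_thetaTail (norm_smoothCoeff_le χ u) (smoothCoeff_zero χ u) _ (pi_div_pos q)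

theorem g_eq {q : ℕ} (χ : DirichletCharacter ℂ q) (s : ℂ) :
    g χ s = (1 / ((Real.pi / q : ℝ) : ℂ)) ^ ((s + kappa χ) / 2) * Gamma ((s + kappa χ) / 2) := by
  rw [g]
  congr 2
  push_cast
  rw [one_div_div]

/-- The finite Euler product, multiplied out. `smoothNumbers N` bounds prime factors strictly by
`N`, hence `⌊u⌋₊ + 1`. -/
theorem LU_eq_LSeries {q : ℕ} (χ : DirichletCharacter ℂ q) (u : ℝ) {s : ℂ} (hs : 1 < s.re) :
    LU χ u s = LSeries (smoothCoeff χ u) s := by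
  have hs0 : s ≠ 0 := ne_zero_of_one_lt_re hs
  have h1 := EulerProduct.prod_primesBelow_geometric_eq_tsum_smoothNumbers
    (f := (dirichletSummandHom χ hs0 : ℕ →* ℂ)) (summable_dirichletSummand χ hs).of_norm (⌊u⌋₊ + 1)
  have h2 : LU χ u s = ∏ p ∈ (⌊u⌋₊ + 1).primesBelow, (1 - dirichletSummandHom χ hs0 p)⁻¹ := by
    refine Finset.prod_congr rfl fun p _ => ?_
    simp [dirichletSummandHom, div_eq_mul_inv, cpow_neg]
  rw [h2]
  refine h1.trans ?_
  rw [LSeries, tsum_subtype (Nat.smoothNumbers (⌊u⌋₊ + 1))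
    (fun m => (dirichletSummandHom χ hs0 : ℕ →* ℂ) m)]
  congr 1
  funext n
  by_cases hn : n ∈ Nat.smoothNumbers (⌊u⌋₊ + 1)
  · rw [indicator_of_mem hn, LSeries.term_of_ne_zero (Nat.ne_zero_of_mem_smoothNumbers hn),
      smoothCoeff, indicator_of_mem hn]
    simp [dirichletSummandHom, div_eq_mul_inv, cpow_neg]
  · rw [indicator_of_notMem hn, LSeries.term_def, smoothCoeff, indicator_of_notMem hn]
    simp

/-- `ξ_u` minus its `smoothTail` decays away from the poles. -/
theorem exists_xiU_sub_smoothTail_bound {q : ℕ} [NeZero q] (χ : DirichletCharacter ℂ q) (u : ℝ)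
    {δ : ℝ} (hδ : 0 < δ) : ∃ C : ℝ, ∀ s : ℂ,
      (∀ p ∈ goodPrimes q u, ∀ h : ℤ, δ ≤ ‖s - eulerPole χ p h‖) →
      (∀ h : ℕ, δ ≤ ‖s + 2 * h + kappa χ‖) →
      ‖(s + kappa χ) / 2‖ * ‖xiU χ u s - smoothTail χ u s‖ ≤ C := by
  obtain ⟨C₁, h₁⟩ := exists_completed_sub_thetaTail_bound (norm_smoothCoeff_le χ u)
    (smoothCoeff_zero χ u) (kappa χ) (pi_div_pos q)
  obtain ⟨C₂, h₂⟩ := exists_thetaTail_bound (norm_smoothCoeff_le χ u)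
    (smoothCoeff_zero χ u) (kappa χ) (pi_div_pos q) 2
  obtain ⟨C₃, h₃⟩ := exists_g_bound χ hδ
  obtain ⟨C₄, h₄0, h₄⟩ := exists_LU_bound χ u hδ
  refine ⟨max C₁ (C₃ * C₄ + C₂), fun s hs1 hs2 => ?_⟩
  -- On the right the difference is a sum of integrals over `(0, 1)`. On the left there is no
  -- cancellation to exploit: `ξ_u` and the tail decay separately.
  rcases le_total 2 s.re with hre | hre
  · refine le_trans ?_ (le_max_left _ _)
    have := h₁ s hre
    rwa [← g_eq, ← LU_eq_LSeries χ u (by linarith)] at this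
  · refine le_trans ?_ (le_max_right _ _)
    calc ‖(s + kappa χ) / 2‖ * ‖xiU χ u s - smoothTail χ u s‖
        ≤ ‖(s + kappa χ) / 2‖ * (‖xiU χ u s‖ + ‖smoothTail χ u s‖) := by
          gcongr
          exact norm_sub_le _ _
      _ = ‖(s + kappa χ) / 2‖ * ‖g χ s‖ * ‖LU χ u s‖ +
          ‖(s + kappa χ) / 2‖ * ‖smoothTail χ u s‖ := by
          rw [xiU, norm_mul]
          ring
      _ ≤ C₃ * C₄ + C₂ := by
          refine add_le_add (mul_le_mul (h₃ s hre hs2) (h₄ s hs1) (norm_nonneg _) ?_) (h₂ s hre).2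
          exact (mul_nonneg (norm_nonneg _) (norm_nonneg _)).trans (h₃ s hre hs2)

/-- The poles of `ξ_u` (and possibly the point `0`). -/
def IsPole {q : ℕ} (χ : DirichletCharacter ℂ q) (u : ℝ) (ρ : ℂ) : Prop :=
  (∃ p ∈ goodPrimes q u, ∃ h : ℤ, ρ = eulerPole χ p h) ∨ ∃ h : ℕ, ρ = -2 * h - kappa χ

theorem finite_isPole {q : ℕ} (χ : DirichletCharacter ℂ q) (u T : ℝ) :
    {ρ | IsPole χ u ρ ∧ ‖ρ‖ < T}.Finite := by
  have h1 : (⋃ p ∈ goodPrimes q u, eulerPole χ p '' {h : ℤ | ‖eulerPole χ p h‖ < T}).Finite :=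
    (goodPrimes q u).finite_toSet.biUnion fun p hp =>
      (finite_eulerPole_lt χ (prime_of_mem_goodPrimes hp) T).image _
  have h2 : ((fun h : ℕ => (-2 * h - kappa χ : ℂ)) '' Iio ⌈T⌉₊).Finite := (finite_Iio _).image _
  refine (h1.union h2).subset ?_
  rintro ρ ⟨⟨p, hp, h, rfl⟩ | ⟨h, rfl⟩, hT⟩
  · exact Or.inl (mem_biUnion hp ⟨h, hT, rfl⟩)
  · refine Or.inr ⟨h, Nat.lt_ceil.2 (lt_of_le_of_lt ?_ hT), rfl⟩
    have e : (-2 * (h : ℂ) - kappa χ) = -((2 * h + kappa χ : ℕ) : ℂ) := by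
      push_cast
      ring
    rw [e, norm_neg, norm_natCast]
    exact_mod_cast (by omega : h ≤ 2 * h + kappa χ)

theorem eventually_not_isPole {q : ℕ} (χ : DirichletCharacter ℂ q) (u : ℝ) (s : ℂ) :
    ∀ᶠ z in 𝓝[≠] s, ¬ IsPole χ u z ∧ z ≠ 0 := by
  have hfin : ({ρ | IsPole χ u ρ ∧ ‖ρ‖ < ‖s‖ + 1} ∪ {0}).Finite :=
    (finite_isPole χ u (‖s‖ + 1)).union (finite_singleton _)
  have h1 : ∀ᶠ z in 𝓝 s, ‖z‖ < ‖s‖ + 1 :=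
    (continuous_norm.continuousAt.tendsto).eventually (gt_mem_nhds (by linarith))
  have h2 := (hfin.sdiff (t := {s})).isClosed.isOpen_compl.mem_nhds
    (fun h => h.2 rfl : s ∈ (({ρ | IsPole χ u ρ ∧ ‖ρ‖ < ‖s‖ + 1} ∪ {0}) \ {s})ᶜ)
  filter_upwards [mem_nhdsWithin_of_mem_nhds h1, mem_nhdsWithin_of_mem_nhds h2,
    self_mem_nhdsWithin] with z hz1 hz2 hz3
  exact ⟨fun h => hz2 ⟨Or.inl ⟨h, hz1⟩, hz3⟩, fun h => hz2 ⟨Or.inr h, hz3⟩⟩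

theorem analyticAt_xiU_of_not_isPole {q : ℕ} [NeZero q] (χ : DirichletCharacter ℂ q) {u : ℝ} {s : ℂ}
    (hs : ¬ IsPole χ u s) : AnalyticAt ℂ (xiU χ u) s :=
  analyticAt_xiU χ (fun p hp h he => hs (Or.inl ⟨p, hp, h, he⟩))
    fun h he => hs (Or.inr ⟨h, he⟩)

/-- The residue of `ξ_u` at a simple pole. -/
noncomputable def residue {q : ℕ} (χ : DirichletCharacter ℂ q) (u : ℝ) (ρ : ℂ) : ℂ :=
  limUnder (𝓝[≠] ρ) fun w => (w - ρ) * xiU χ u w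

theorem tendsto_residue {q : ℕ} [NeZero q] (χ : DirichletCharacter ℂ q) {u : ℝ} {ρ : ℂ}
    (hρ : IsPole χ u ρ) (h0 : ρ ≠ 0) :
    Tendsto (fun w => (w - ρ) * xiU χ u w) (𝓝[≠] ρ) (𝓝 (residue χ u ρ)) := by
  rcases hρ with ⟨p, hp, h, rfl⟩ | ⟨h, rfl⟩
  · have := tendsto_mul_xiU_eulerPole χ hp h0
    rwa [residue, this.limUnder_eq]
  · have := tendsto_mul_xiU_gammaPole χ u (mt (gammaPole_eq_zero_iff _ _).2 h0)
    rwa [residue, this.limUnder_eq]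

/-- The principal part of `ξ_u` at the pole `-2h - κ ≠ 0` of the Gamma factor. -/
noncomputable def gammaTerm {q : ℕ} (χ : DirichletCharacter ℂ q) (u : ℝ) (s : ℂ) (h : ℕ) : ℂ :=
  if 2 * h + kappa χ = 0 then 0 else
    2 * (-1) ^ h * (Real.pi : ℂ) ^ h * LU χ u (-2 * h - kappa χ) /
      ((q : ℂ) ^ h * Gamma (h + 1) * (s + 2 * h + kappa χ))

theorem gammaTerm_eq {q : ℕ} [NeZero q] (χ : DirichletCharacter ℂ q) (u : ℝ) (s : ℂ) {h : ℕ}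
    (h0 : 2 * h + kappa χ ≠ 0) :
    gammaTerm χ u s h = residue χ u (-2 * h - kappa χ) / (s - (-2 * h - kappa χ)) := by
  rw [gammaTerm, if_neg h0, residue, (tendsto_mul_xiU_gammaPole χ u h0).limUnder_eq, div_div]
  ring

theorem eulerTerm_eq {q : ℕ} [NeZero q] (χ : DirichletCharacter ℂ q) {u : ℝ} (s : ℂ) {p : ℕ}
    (hp : p ∈ goodPrimes q u) {h : ℤ} (h0 : eulerPole χ p h ≠ 0) :
    eulerTerm χ u p s h = residue χ u (eulerPole χ p h) / (s - eulerPole χ p h) := by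
  rw [eulerTerm, if_neg h0, residue, (tendsto_mul_xiU_eulerPole χ hp h0).limUnder_eq, div_div,
    mul_comm (s - _)]

/-- Cauchy's formula needs a sum over the set of poles. Passing from pairs `(p, h)` to poles loses
nothing by `eulerPole_injective`, and pairs at the point `0` contribute `0`. -/
theorem eulerPartTrunc_eq_sum {q : ℕ} [NeZero q] (χ : DirichletCharacter ℂ q) (u T : ℝ) :
    ∃ Z : Finset ℂ, (∀ ρ, ρ ∈ Z ↔ ρ ≠ 0 ∧ ‖ρ‖ < T ∧ ∃ p ∈ goodPrimes q u, ∃ h : ℤ,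
      ρ = eulerPole χ p h) ∧
      ∀ s, eulerPartTrunc χ u T s = ∑ ρ ∈ Z, residue χ u ρ / (s - ρ) := by
  classical
  have hfin : ∀ p ∈ goodPrimes q u, {h : ℤ | ‖eulerPole χ p h‖ < T}.Finite := fun p hp =>
    finite_eulerPole_lt χ (prime_of_mem_goodPrimes hp) T
  set N : ℕ → Finset ℤ := fun p => if hp : p ∈ goodPrimes q u then
    (hfin p hp).toFinset.filter (fun h => eulerPole χ p h ≠ 0) else ∅ with hN
  have hNm : ∀ p ∈ goodPrimes q u, ∀ h, h ∈ N p ↔ ‖eulerPole χ p h‖ < T ∧ eulerPole χ p h ≠ 0 := by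
    intro p hp h
    simp [hN, hp]
  set X : Finset (Σ _ : ℕ, ℤ) := (goodPrimes q u).sigma N with hX
  refine ⟨X.image fun x => eulerPole χ x.1 x.2, fun ρ => ?_, fun s => ?_⟩
  · simp only [Finset.mem_image, hX, Finset.mem_sigma]
    constructor
    · rintro ⟨⟨p, h⟩, ⟨hp, hh⟩, rfl⟩
      exact ⟨((hNm p hp h).1 hh).2, ((hNm p hp h).1 hh).1, p, hp, h, rfl⟩
    · rintro ⟨h0, hT, p, hp, h, rfl⟩
      exact ⟨⟨p, h⟩, ⟨hp, (hNm p hp h).2 ⟨hT, h0⟩⟩, rfl⟩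
  · rw [Finset.sum_image, hX, Finset.sum_sigma]
    · refine Finset.sum_congr rfl fun p hp => ?_
      refine (finsum_mem_eq_finite_toFinset_sum _ (hfin p hp)).trans ?_
      have e : N p = (hfin p hp).toFinset.filter (fun h => eulerPole χ p h ≠ 0) := by simp [hN, hp]
      rw [e, Finset.sum_filter]
      refine Finset.sum_congr rfl fun h _ => ?_
      split_ifs with h0
      · exact eulerTerm_eq χ s hp h0
      · rw [eulerTerm, if_pos (not_not.1 h0)]
    · rintro ⟨p, h⟩ hx ⟨r, k⟩ hy he
      simp only [hX, Finset.coe_sigma, Set.mem_sigma_iff, Finset.mem_coe] at hx hy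
      obtain ⟨rfl, rfl⟩ := eulerPole_injective χ (prime_of_mem_goodPrimes hx.1)
        (mem_goodPrimes.1 hx.1).2 (prime_of_mem_goodPrimes hy.1) (mem_goodPrimes.1 hy.1).2
        ((hNm p hx.1 h).1 hx.2).2 he
      rfl

theorem gammaTerm_sum_eq {q : ℕ} [NeZero q] (χ : DirichletCharacter ℂ q) (u : ℝ) (M : ℕ) :
    ∃ Z : Finset ℂ, (∀ ρ, ρ ∈ Z ↔ ρ ≠ 0 ∧ ∃ h < M, ρ = -2 * (h : ℕ) - kappa χ) ∧
      ∀ s, ∑ h ∈ Finset.range M, gammaTerm χ u s h = ∑ ρ ∈ Z, residue χ u ρ / (s - ρ) := by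
  classical
  refine ⟨((Finset.range M).filter fun h => 2 * h + kappa χ ≠ 0).image
    fun h : ℕ => (-2 * h - kappa χ : ℂ), fun ρ => ?_, fun s => ?_⟩
  · simp only [Finset.mem_image, Finset.mem_filter, Finset.mem_range]
    constructor
    · rintro ⟨h, ⟨hM, h0⟩, rfl⟩
      exact ⟨mt (gammaPole_eq_zero_iff _ _).1 h0, h, hM, rfl⟩
    · rintro ⟨h0, h, hM, rfl⟩
      exact ⟨h, ⟨hM, mt (gammaPole_eq_zero_iff _ _).2 h0⟩, rfl⟩
  · rw [Finset.sum_image, Finset.sum_filter]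
    · refine Finset.sum_congr rfl fun h _ => ?_
      split_ifs with h0
      · exact gammaTerm_eq χ u s h0
      · rw [gammaTerm, if_pos (not_not.1 h0)]
    · intro h _ k _ he
      have : (h : ℂ) = k := by
        simp only at he
        linear_combination -he / 2
      exact_mod_cast this

/-! ### Summation of the principal parts over growing disks -/

/-- A radius `T` that avoids the Euler poles can be moved slightly to avoid `2 h + κ` as well. -/
theorem exists_radius {δ T : ℝ} (hδ : 0 < δ) (k : ℕ) :
    ∃ T' : ℝ, T ≤ T' ∧ T' ≤ T + 2 * (min δ 1 / 4) ∧ ∀ h : ℕ,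
      min δ 1 / 4 ≤ |T' - (2 * h + k)| := by
  -- A shift by `2 * e ≤ δ / 2` preserves half of a separation `δ` from the Euler poles. The numbers
  -- `2 * h + k` are spaced by `2` and `2 * e ≤ 1 / 2`, so moving away from one of them does not
  -- come near another.
  set e := min δ 1 / 4 with he
  have h1 : min δ 1 ≤ 1 := min_le_right _ _
  have h0 : 0 < min δ 1 := lt_min hδ one_pos
  have he0 : 0 < e := by positivity
  by_cases H : ∀ h : ℕ, e ≤ |T - (2 * h + k)|
  · exact ⟨T, le_rfl, by linarith, H⟩
  push Not at H
  obtain ⟨m, hm⟩ := H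
  rw [abs_lt] at hm
  refine ⟨T + 2 * e, by linarith, le_rfl, fun h => ?_⟩
  rw [le_abs]
  rcases le_or_gt h m with hle | hgt
  · left
    have : (h : ℝ) ≤ m := by exact_mod_cast hle
    linarith [hm.1, hm.2]
  · right
    have : (m : ℝ) + 1 ≤ h := by exact_mod_cast hgt
    linarith [hm.1, hm.2]

theorem norm_add_two_mul_add (h k : ℕ) (s : ℂ) :
    |‖s‖ - (2 * h + k)| ≤ ‖s + 2 * h + k‖ := by
  have e : s + 2 * h + k = s - (-((2 * h + k : ℕ) : ℂ)) := by push_cast; ring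
  have := abs_norm_sub_norm_le s (-((2 * h + k : ℕ) : ℂ))
  rw [norm_neg, norm_natCast] at this
  rw [e]
  push_cast at this ⊢
  exact this

/-- On separated radii the truncated principal part approximates `ξ_u` minus its `smoothTail`. -/
theorem exists_truncation {q : ℕ} [NeZero q] (χ : DirichletCharacter ℂ q) (u : ℝ) {δ : ℝ}
    (hδ : 0 < δ) : ∃ C : ℝ, ∀ T : ℝ, 2 ≤ T →
      (∀ p ∈ goodPrimes q u, ∀ h : ℤ, δ ≤ |T - ‖eulerPole χ p h‖|) → ∃ M : ℕ, T ≤ 2 * M + 2 ∧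
      ∀ s : ℂ, ‖s‖ < T → ∃ e : ℂ, ‖e‖ ≤ C / (T - ‖s‖) ∧
        Tendsto (fun w => xiU χ u w - smoothTail χ u w - (eulerPartTrunc χ u T w +
          ∑ h ∈ Finset.range M, gammaTerm χ u w h + principalPartAtZero (xiU χ u) w))
          (𝓝[≠] s) (𝓝 e) := by
  classical
  set η := min δ 1 / 4 with hη
  have hmin1 : min δ 1 ≤ 1 := min_le_right _ _
  have hminδ : min δ 1 ≤ δ := min_le_left _ _
  have hmin0 : 0 < min δ 1 := lt_min hδ one_pos
  have hη0 : 0 < η := by positivity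
  obtain ⟨C, hC⟩ := exists_xiU_sub_smoothTail_bound χ u hη0
  obtain ⟨m, d, G, hG, hd⟩ := exists_polar_part (meromorphicAt_xiU χ u 0)
  have hPP := principalPartAtZero_eq hG hd
  refine ⟨4 * |C|, fun T hT hsep => ?_⟩
  have hκ : kappa χ ≤ 1 := by
    rw [kappa]
    split_ifs <;> simp
  have hκ' : (kappa χ : ℝ) ≤ 1 := by exact_mod_cast hκ
  obtain ⟨T', hTT', hT'T, hT'⟩ := exists_radius (T := T) hδ (kappa χ)
  have hsep' : ∀ p ∈ goodPrimes q u, ∀ h : ℤ, η ≤ |T' - ‖eulerPole χ p h‖| := by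
    intro p hp h
    have h1 := hsep p hp h
    rcases le_abs.1 h1 with h2 | h2
    · exact le_abs.2 (Or.inl (by linarith))
    · exact le_abs.2 (Or.inr (by linarith))
  -- No Euler pole has modulus between `T` and `T'`, so the Euler sum truncated at `T` is also the
  -- one for the circle of radius `T'`.
  have hlt : ∀ p ∈ goodPrimes q u, ∀ h : ℤ, ‖eulerPole χ p h‖ < T' → ‖eulerPole χ p h‖ < T := by
    intro p hp h h1
    rcases le_abs.1 (hsep p hp h) with h2 | h2 <;> linarith
  set M := ⌈(T' - kappa χ) / 2⌉₊ with hM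
  have hMlt : ∀ h : ℕ, h < M ↔ 2 * (h : ℝ) + kappa χ < T' := by
    intro h
    rw [hM, Nat.lt_ceil, lt_div_iff₀ two_pos]
    constructor <;> intro h <;> linarith
  have hnormG : ∀ h : ℕ, ‖(-2 * (h : ℂ) - kappa χ)‖ = 2 * h + kappa χ := by
    intro h
    have e : (-2 * (h : ℂ) - kappa χ) = -((2 * h + kappa χ : ℕ) : ℂ) := by
      push_cast
      ring
    rw [e, norm_neg, norm_natCast]
    push_cast
    ring
  obtain ⟨ZE, hZE, hE⟩ := eulerPartTrunc_eq_sum χ u T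
  obtain ⟨ZG, hZG, hGs⟩ := gammaTerm_sum_eq χ u M
  have hdisj : Disjoint ZE ZG := by
    refine Finset.disjoint_left.2 fun ρ h1 h2 => ?_
    obtain ⟨h0, -, p, -, h, rfl⟩ := (hZE ρ).1 h1
    obtain ⟨-, k, -, hk⟩ := (hZG _).1 h2
    exact eulerPole_ne_gammaPole χ p h k _ (fun h3 => h0 (hk.trans
      ((gammaPole_eq_zero_iff _ _).2 h3))) hk
  have hpole : ∀ ρ ∈ ZE ∪ ZG, IsPole χ u ρ ∧ ρ ≠ 0 ∧ ‖ρ‖ < T' := by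
    intro ρ hρ
    rcases Finset.mem_union.1 hρ with h | h
    · obtain ⟨h0, h1, h2⟩ := (hZE ρ).1 h
      exact ⟨Or.inl h2, h0, h1.trans_le hTT'⟩
    · obtain ⟨h0, k, hk, rfl⟩ := (hZG ρ).1 h
      exact ⟨Or.inr ⟨k, rfl⟩, h0, by rw [hnormG]; exact (hMlt k).1 hk⟩
  have hnot : ∀ w : ℂ, ‖w‖ ≤ T' → w ∉ ZE ∪ ZG → w ≠ 0 → ¬ IsPole χ u w := by
    rintro w hw hwZ h0 (⟨p, hp, h, rfl⟩ | ⟨h, rfl⟩)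
    · have h1 : ‖eulerPole χ p h‖ < T' := by
        refine lt_of_le_of_ne hw fun he => ?_
        have := hsep' p hp h
        rw [he, sub_self, abs_zero] at this
        linarith
      exact hwZ (Finset.mem_union_left _ ((hZE _).2 ⟨h0, hlt p hp h h1, p, hp, h, rfl⟩))
    · rw [hnormG] at hw
      have h1 : 2 * (h : ℝ) + kappa χ < T' := by
        refine lt_of_le_of_ne hw fun he => ?_
        have := hT' h
        rw [he, sub_self, abs_zero] at this
        linarith
      exact hwZ (Finset.mem_union_right _ ((hZG _).2 ⟨h0, h, (hMlt h).2 h1, rfl⟩))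
  have hR : ∀ w, AnalyticAt ℂ (smoothTail χ u) w := fun w =>
    (differentiable_smoothTail χ u).analyticAt w
  have hT'0 : 0 < T' := by linarith
  have hres : ∀ ρ ∈ ZE ∪ ZG, Tendsto (fun w => (w - ρ) * (xiU χ u w - smoothTail χ u w)) (𝓝[≠] ρ)
      (𝓝 (residue χ u ρ)) := by
    intro ρ hρ
    have h1 := tendsto_residue χ (hpole ρ hρ).1 (hpole ρ hρ).2.1
    have h2 : Tendsto (fun w => (w - ρ) * smoothTail χ u w) (𝓝[≠] ρ) (𝓝 0) := by
      have h3 : ContinuousAt (fun w => (w - ρ) * smoothTail χ u w) ρ :=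
        (by fun_prop : ContinuousAt (fun w => w - ρ) ρ).mul (hR ρ).continuousAt
      have h4 := h3.tendsto
      simp only [sub_self, zero_mul] at h4
      exact h4.mono_left nhdsWithin_le_nhds
    have h3 := h1.sub h2
    rw [sub_zero] at h3
    exact h3.congr fun w => by ring
  have hzero : ∀ᶠ z in 𝓝[≠] (0 : ℂ), xiU χ u z - smoothTail χ u z =
      ∑ k ∈ Finset.range m, d k / z ^ (k + 1) + (G z - smoothTail χ u z) := by
    filter_upwards [hd] with z hz
    rw [hz]
    ring
  have hsphere : ∀ w : ℂ, ‖w‖ = T' → ‖xiU χ u w - smoothTail χ u w‖ ≤ 4 * |C| / T' := by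
    intro w hw
    have h1 := hC w (fun p hp h => ?_) (fun h => ?_)
    -- `(T' - 1) / 2 ≥ T' / 4` because `T' ≥ 2`; this is the source of the constant `4 * |C|`.
    · have h2 : T' / 4 ≤ ‖(w + kappa χ) / 2‖ := by
        have h3 := norm_sub_norm_le w (-(kappa χ : ℂ))
        rw [sub_neg_eq_add, norm_neg, norm_natCast, hw] at h3
        rw [norm_div, RCLike.norm_ofNat]
        linarith
      have h4 := (mul_le_mul_of_nonneg_right h2 (norm_nonneg
        (xiU χ u w - smoothTail χ u w))).trans (h1.trans (le_abs_self C))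
      rw [le_div_iff₀ hT'0]
      linarith
    · have h2 := abs_norm_sub_norm_le w (eulerPole χ p h)
      rw [hw] at h2
      exact (hsep' p hp h).trans h2
    · have h2 := norm_add_two_mul_add h (kappa χ) w
      rw [hw] at h2
      exact (hT' h).trans h2
  refine ⟨M, ?_, fun s hs => ?_⟩
  · have := Nat.le_ceil ((T' - kappa χ) / 2)
    rw [← hM] at this
    linarith
  obtain ⟨e, he, hlim⟩ := exists_tendsto_sub_principal_parts (ZE ∪ ZG) (residue χ u) m d
    (fun ρ hρ => (hpole ρ hρ).2)
    (fun w hw hwZ h0 => (analyticAt_xiU_of_not_isPole χ (hnot w hw hwZ h0)).sub (hR w))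
    hres (hG.sub (hR 0)) hzero hsphere (hs.trans_le hTT')
  refine ⟨e, he.trans ?_, hlim.congr fun w => ?_⟩
  · have h1 : 0 < T - ‖s‖ := sub_pos.2 hs
    have h2 : 4 * |C| / T' * T' = 4 * |C| := by field_simp
    rw [h2]
    exact div_le_div_of_nonneg_left (by positivity) h1 (by linarith)
  · rw [hE, hGs, hPP, Finset.sum_union hdisj]
    rfl

/-- The Euler poles lie on the imaginary axis, so `L_u` is uniformly bounded at the Gamma poles with
`h ≥ 1`, and the factorial forces convergence. -/
theorem summable_gammaTerm {q : ℕ} [NeZero q] (χ : DirichletCharacter ℂ q) (u : ℝ) (s : ℂ) :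
    Summable (gammaTerm χ u s) := by
  obtain ⟨C, hC0, hC⟩ := exists_LU_bound χ u one_pos
  have hq : (0 : ℝ) < q := by exact_mod_cast NeZero.pos q
  refine Summable.of_norm_bounded_eventually_nat
    ((Real.summable_pow_div_factorial (Real.pi / q)).mul_left (2 * C)) ?_
  filter_upwards [eventually_ge_atTop ⌈‖s‖ + 1⌉₊] with h hh
  have hh' : ‖s‖ + 1 ≤ h := Nat.ceil_le.1 hh
  have hh1 : (1 : ℝ) ≤ h := by linarith [norm_nonneg s]
  have hκ : (0 : ℝ) ≤ kappa χ := Nat.cast_nonneg _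
  rw [gammaTerm]
  split_ifs with h0
  · rw [norm_zero]
    positivity
  have hden : 1 ≤ ‖s + 2 * h + kappa χ‖ := by
    refine le_trans (le_abs.2 (Or.inr ?_)) (norm_add_two_mul_add h (kappa χ) s)
    linarith
  have hL : ‖LU χ u (-2 * h - kappa χ)‖ ≤ C := by
    refine hC _ fun p _ k => ?_
    refine le_trans ?_ (abs_re_le_norm _)
    have : (-2 * (h : ℂ) - kappa χ - eulerPole χ p k).re = -(2 * h + kappa χ) := by
      rw [sub_re, eulerPole_re]
      simp
      ring
    rw [this, abs_neg, abs_of_nonneg (by positivity)]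
    linarith
  have hfac : (0 : ℝ) < h.factorial := by exact_mod_cast h.factorial_pos
  rw [Gamma_nat_eq_factorial]
  simp only [norm_div, norm_mul, norm_pow, norm_neg, norm_one, one_pow, mul_one, norm_natCast,
    norm_real, Real.norm_eq_abs, abs_of_pos Real.pi_pos, RCLike.norm_ofNat]
  rw [div_pow, div_div, mul_div_assoc']
  refine div_le_div₀ (by positivity) ?_ (by positivity) ?_
  · nlinarith [pow_pos Real.pi_pos h]
  · exact le_mul_of_one_le_right (by positivity) hden

theorem continuousAt_gammaTerm {q : ℕ} [NeZero q] (χ : DirichletCharacter ℂ q) (u : ℝ) {s : ℂ}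
    {h : ℕ} (hs : s ≠ -2 * h - kappa χ) : ContinuousAt (fun w => gammaTerm χ u w h) s := by
  by_cases h0 : 2 * h + kappa χ = 0
  · simp only [gammaTerm, if_pos h0]
    exact continuousAt_const
  · simp only [gammaTerm_eq χ u _ h0]
    exact continuousAt_const.div (by fun_prop) (sub_ne_zero.2 hs)

theorem continuousAt_eulerPartTrunc {q : ℕ} [NeZero q] (χ : DirichletCharacter ℂ q) {u T : ℝ}
    {s : ℂ} (hs : ∀ p ∈ goodPrimes q u, ∀ h : ℤ, s ≠ eulerPole χ p h) :
    ContinuousAt (eulerPartTrunc χ u T) s := by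
  obtain ⟨Z, hZ, hE⟩ := eulerPartTrunc_eq_sum χ u T
  rw [funext hE]
  refine tendsto_finsetSum _ fun ρ hρ => ?_
  obtain ⟨-, -, p, hp, h, rfl⟩ := (hZ ρ).1 hρ
  exact (continuousAt_const.div (by fun_prop) (sub_ne_zero.2 (hs p hp h)) :
    ContinuousAt (fun w => residue χ u (eulerPole χ p h) / (w - eulerPole χ p h)) s)

/-- The truncation at `T` is compared with a fixed one at `T₀`. In the difference of the two
formulas from `exists_truncation` the function `ξ_u`, its tail and the principal part at `0` cancel,
so the limit exists even where `s` is a Gamma pole or `0`. Off the poles the formula at `T₀` itself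
gives its value. -/
theorem exists_tendsto_eulerPartTrunc {q : ℕ} [NeZero q] (χ : DirichletCharacter ℂ q) {u : ℝ}
    {s : ℂ} (hs : ∀ p ∈ goodPrimes q u, ∀ h : ℤ, s ≠ eulerPole χ p h) :
    ∃ ℓ : ℂ, Tendsto (fun T => eulerPartTrunc χ u T s) (separatedRadii χ u) (𝓝 ℓ) ∧
      (¬ IsPole χ u s → s ≠ 0 → ℓ = xiU χ u s - smoothTail χ u s - gammaPart χ u s -
        principalPartAtZero (xiU χ u) s) := by
  have hnb := separatedRadii_neBot χ u
  obtain ⟨δ₀, hnb⟩ := iSup_neBot.1 hnb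
  obtain ⟨hδ₀, hnb⟩ := iSup_neBot.1 hnb
  have hfreq := frequently_mem_iff_neBot.2 hnb
  -- The margin `3` gives `2 * M₀ ≥ ‖s‖ + 1`, so every Gamma pole with index at least `M₀` has
  -- modulus greater than `‖s‖`.
  obtain ⟨T₀, hT₀, hsep₀⟩ := (frequently_atTop.1 hfreq) (‖s‖ + 3)
  obtain ⟨C₀, hC₀⟩ := exists_truncation χ u hδ₀
  obtain ⟨M₀, hM₀, H₀⟩ := hC₀ T₀ (by linarith [norm_nonneg s]) hsep₀
  obtain ⟨e₀, -, he₀⟩ := H₀ s (by linarith)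
  have hgs := (summable_gammaTerm χ u s).hasSum
  have hg : ∑' h, gammaTerm χ u s h = gammaPart χ u s := rfl
  rw [hg] at hgs
  refine ⟨eulerPartTrunc χ u T₀ s + e₀ + ∑ h ∈ Finset.range M₀, gammaTerm χ u s h -
    gammaPart χ u s, ?_, fun hp h0 => ?_⟩
  -- Each separation `δ` is treated on its own; the limit is the same for all because it is written
  -- in terms of the fixed `T₀`.
  · refine tendsto_iSup.2 fun δ => tendsto_iSup.2 fun hδ => ?_
    obtain ⟨C, hC⟩ := exists_truncation χ u hδ
    rw [Metric.tendsto_nhds]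
    intro ε hε
    have hCt : Tendsto (fun T : ℝ => C / (T - ‖s‖)) atTop (𝓝 0) :=
      tendsto_const_nhds.div_atTop (tendsto_atTop_add_const_right _ _ tendsto_id)
    obtain ⟨N, hN⟩ := (Metric.tendsto_atTop.1 hgs.tendsto_sum_nat) (ε / 2) (half_pos hε)
    rw [eventually_inf_principal]
    filter_upwards [eventually_ge_atTop T₀, eventually_ge_atTop (2 * M₀ + 2 : ℝ),
      eventually_ge_atTop (2 * N + 2 : ℝ),
      hCt.eventually (gt_mem_nhds (half_pos hε))] with T hT1 hT2 hT3 hT4 hsep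
    obtain ⟨M, hM, H⟩ := hC T (by linarith [norm_nonneg s]) hsep
    obtain ⟨e, hee, he⟩ := H s (by linarith)
    have hMM₀ : M₀ ≤ M := by
      have : (M₀ : ℝ) ≤ M := by linarith
      exact_mod_cast this
    have hMN : N ≤ M := by
      have : (N : ℝ) ≤ M := by linarith
      exact_mod_cast this
    -- Only Gamma terms with `M₀ ≤ h < M` remain, and none of them has its pole at `s`.
    have hcd : ContinuousAt (fun w => eulerPartTrunc χ u T w - eulerPartTrunc χ u T₀ w +
        ∑ h ∈ Finset.Ico M₀ M, gammaTerm χ u w h) s := by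
      refine ((continuousAt_eulerPartTrunc χ hs).sub (continuousAt_eulerPartTrunc χ hs)).add ?_
      refine tendsto_finsetSum _ fun h hh => (continuousAt_gammaTerm χ u fun h1 => ?_).tendsto
      have h2 := congrArg norm h1
      have e : (-2 * (h : ℂ) - kappa χ) = -((2 * h + kappa χ : ℕ) : ℂ) := by
        push_cast
        ring
      rw [e, norm_neg, norm_natCast] at h2
      have h3 : (M₀ : ℝ) ≤ h := by exact_mod_cast (Finset.mem_Ico.1 hh).1
      have h4 : (0 : ℝ) ≤ kappa χ := Nat.cast_nonneg _
      push_cast at h2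
      linarith
    have hlim := hcd.tendsto.mono_left (nhdsWithin_le_nhds (s := {s}ᶜ))
    have hlim2 := he₀.sub he
    have huniq := tendsto_nhds_unique hlim (hlim2.congr fun w => by
      rw [Finset.sum_Ico_eq_sub _ hMM₀]
      ring)
    rw [Finset.sum_Ico_eq_sub _ hMM₀] at huniq
    have hval : eulerPartTrunc χ u T s - (eulerPartTrunc χ u T₀ s + e₀ +
        ∑ h ∈ Finset.range M₀, gammaTerm χ u s h - gammaPart χ u s) =
        -e - (∑ h ∈ Finset.range M, gammaTerm χ u s h - gammaPart χ u s) := by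
      linear_combination huniq
    rw [dist_eq_norm, hval]
    have h5 := hN M hMN
    rw [dist_eq_norm] at h5
    calc _ ≤ ‖-e‖ + ‖∑ h ∈ Finset.range M, gammaTerm χ u s h - gammaPart χ u s‖ :=
          norm_sub_le _ _
      _ < ε / 2 + ε / 2 := by
          rw [norm_neg]
          exact add_lt_add (hee.trans_lt hT4) h5
      _ = ε := add_halves ε
  · obtain ⟨m, d, G, hG, hd⟩ := exists_polar_part (meromorphicAt_xiU χ u 0)
    have hPP := principalPartAtZero_eq hG hd
    have hc : ContinuousAt (fun w => xiU χ u w - smoothTail χ u w - (eulerPartTrunc χ u T₀ w +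
        ∑ h ∈ Finset.range M₀, gammaTerm χ u w h + principalPartAtZero (xiU χ u) w)) s := by
      refine ((analyticAt_xiU_of_not_isPole χ hp).continuousAt.sub
        (differentiable_smoothTail χ u s).continuousAt).sub
        (((continuousAt_eulerPartTrunc χ hs).add ?_).add ?_)
      · exact tendsto_finsetSum _ fun h _ =>
          (continuousAt_gammaTerm χ u fun h1 => hp (Or.inr ⟨h, h1⟩)).tendsto
      · rw [funext hPP]
        refine tendsto_finsetSum _ fun k _ => ?_
        exact (continuousAt_const.div (by fun_prop) (pow_ne_zero _ h0) :
          ContinuousAt (fun w => d k / w ^ (k + 1)) s)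
    have huniq := tendsto_nhds_unique he₀ (hc.tendsto.mono_left nhdsWithin_le_nhds)
    rw [huniq]
    ring

theorem tendsto_eulerPart {q : ℕ} [NeZero q] (χ : DirichletCharacter ℂ q) {u : ℝ}
    {s : ℂ} (hs : ∀ p ∈ goodPrimes q u, ∀ h : ℤ, s ≠ eulerPole χ p h) :
    Tendsto (fun T => eulerPartTrunc χ u T s) (separatedRadii χ u) (𝓝 (eulerPart χ u s)) := by
  have := separatedRadii_neBot χ u
  obtain ⟨ℓ, hℓ, -⟩ := exists_tendsto_eulerPartTrunc χ hs
  rwa [eulerPart, hℓ.limUnder_eq]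

theorem xiU_sub_xiPP {q : ℕ} [NeZero q] (χ : DirichletCharacter ℂ q) {u : ℝ} {s : ℂ}
    (hs : ¬ IsPole χ u s) (h0 : s ≠ 0) : xiU χ u s - xiPP χ u s = smoothTail χ u s := by
  have := separatedRadii_neBot χ u
  obtain ⟨ℓ, hℓ, h⟩ := exists_tendsto_eulerPartTrunc χ
    (s := s) (u := u) fun p hp k hk => hs (Or.inl ⟨p, hp, k, hk⟩)
  rw [xiPP, eulerPart, hℓ.limUnder_eq, h hs h0]
  ring

theorem tendsto_xiU_sub_xiPP {q : ℕ} [NeZero q] (χ : DirichletCharacter ℂ q) (u : ℝ) (s : ℂ) :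
    Tendsto (fun z => xiU χ u z - xiPP χ u z) (𝓝[≠] s) (𝓝 (smoothTail χ u s)) := by
  refine ((differentiable_smoothTail χ u s).continuousAt.tendsto.mono_left
    nhdsWithin_le_nhds).congr' ?_
  filter_upwards [eventually_not_isPole χ u s] with z hz
  exact (xiU_sub_xiPP χ hz.1 hz.2).symm

/-- Off a discrete set `ξ_u - ξ_u^pp` equals the tail, and the entire tail supplies the missing
values. -/
theorem xiReg_eq {q : ℕ} [NeZero q] (χ : DirichletCharacter ℂ q) (u : ℝ) :
    xiReg χ u = smoothTail χ u :=
  funext fun s => (tendsto_xiU_sub_xiPP χ u s).limUnder_eq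

/-! ### Boundedness of `ξ` on vertical strips, and its functional equation -/

/-- `F` is bounded on every vertical strip of finite width. -/
def BoundedOnStrips (F : ℂ → ℂ) : Prop :=
  ∀ σ₁ σ₂ : ℝ, ∃ C : ℝ, ∀ s : ℂ, σ₁ ≤ s.re → s.re ≤ σ₂ → ‖F s‖ ≤ C

theorem BoundedOnStrips.add {F G : ℂ → ℂ} (hF : BoundedOnStrips F) (hG : BoundedOnStrips G) :
    BoundedOnStrips fun s => F s + G s := by
  intro σ₁ σ₂
  obtain ⟨C, hC⟩ := hF σ₁ σ₂
  obtain ⟨D, hD⟩ := hG σ₁ σ₂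
  exact ⟨C + D, fun s h1 h2 => (norm_add_le _ _).trans (add_le_add (hC s h1 h2) (hD s h1 h2))⟩

theorem BoundedOnStrips.mul {F G : ℂ → ℂ} (hF : BoundedOnStrips F) (hG : BoundedOnStrips G) :
    BoundedOnStrips fun s => F s * G s := by
  intro σ₁ σ₂
  obtain ⟨C, hC⟩ := hF σ₁ σ₂
  obtain ⟨D, hD⟩ := hG σ₁ σ₂
  refine ⟨C * D, fun s h1 h2 => ?_⟩
  rw [norm_mul]
  exact mul_le_mul (hC s h1 h2) (hD s h1 h2) (norm_nonneg _) ((norm_nonneg _).trans (hC s h1 h2))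

theorem boundedOnStrips_const (c : ℂ) : BoundedOnStrips fun _ => c :=
  fun _ _ => ⟨‖c‖, fun _ _ _ => le_rfl⟩

theorem BoundedOnStrips.const_mul {F : ℂ → ℂ} (hF : BoundedOnStrips F) (c : ℂ) :
    BoundedOnStrips fun s => c * F s :=
  (boundedOnStrips_const c).mul hF

theorem boundedOnStrips_sum {ι : Type*} {F : ι → ℂ → ℂ} (S : Finset ι)
    (hF : ∀ i, BoundedOnStrips (F i)) : BoundedOnStrips fun s => ∑ i ∈ S, F i s := by
  classical
  induction S using Finset.induction_on with
  | empty => simpa using boundedOnStrips_const 0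
  | insert i S hi ih => simpa [Finset.sum_insert hi] using (hF i).add ih

theorem BoundedOnStrips.comp_add_div_two {F : ℂ → ℂ} (hF : BoundedOnStrips F) (a : ℝ) :
    BoundedOnStrips fun s => F ((s + a) / 2) := by
  intro σ₁ σ₂
  obtain ⟨C, hC⟩ := hF ((σ₁ + a) / 2) ((σ₂ + a) / 2)
  have e : ∀ s : ℂ, ((s + a) / 2).re = (s.re + a) / 2 := fun s => by
    rw [div_ofNat_re, add_re, ofReal_re]
  exact ⟨C, fun s h1 h2 => hC _ (by rw [e]; linarith) (by rw [e]; linarith)⟩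

theorem boundedOnStrips_of_re {F : ℂ → ℂ} {f : ℝ → ℝ} (hf : Continuous f)
    (h : ∀ s, ‖F s‖ ≤ f s.re) : BoundedOnStrips F := by
  intro σ₁ σ₂
  obtain ⟨C, hC⟩ := (isCompact_Icc (a := σ₁) (b := σ₂)).bddAbove_image hf.continuousOn
  exact ⟨C, fun s h1 h2 => (h s).trans (hC ⟨s.re, ⟨h1, h2⟩, rfl⟩)⟩

theorem boundedOnStrips_natCast_cpow {q : ℕ} (hq : 0 < q) {a b : ℂ} :
    BoundedOnStrips fun s => (q : ℂ) ^ (a.re * s + b) := by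
  have h0 : (0 : ℝ) < q := by exact_mod_cast hq
  refine boundedOnStrips_of_re (f := fun σ => (q : ℝ) ^ (a.re * σ + b.re))
    (continuous_const.rpow (by fun_prop) fun _ => Or.inl h0.ne') fun s => ?_
  rw [norm_natCast_cpow_of_pos hq]
  simp

/-- In the strip `|t ^ (s - 1)|` is at most the sum of its values on the two edges, where the
integral converges absolutely. -/
theorem boundedOnStrips_mellin {f : ℝ → ℂ} (hf : ∀ s, MellinConvergent f s) :
    BoundedOnStrips (mellin f) := by
  intro σ₁ σ₂
  have hint : ∀ σ : ℝ, IntegrableOn (fun t : ℝ => t ^ (σ - 1) * ‖f t‖) (Ioi 0) := fun σ => by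
    refine IntegrableOn.congr_fun (hf σ).norm (fun t ht => ?_) measurableSet_Ioi
    simp only [norm_smul]
    rw [norm_cpow_eq_rpow_re_of_pos ht]
    simp
  refine ⟨∫ t in Ioi (0 : ℝ), (t ^ (σ₁ - 1) * ‖f t‖ + t ^ (σ₂ - 1) * ‖f t‖), fun s h1 h2 => ?_⟩
  refine norm_integral_le_of_norm_le ((hint σ₁).add (hint σ₂)) ?_
  refine (ae_restrict_iff' measurableSet_Ioi).2 (Eventually.of_forall fun t ht => ?_)
  rw [norm_smul, norm_cpow_eq_rpow_re_of_pos ht, ← add_mul]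
  refine mul_le_mul_of_nonneg_right ?_ (norm_nonneg _)
  have ht0 : 0 < t := ht
  have hre : (s - 1).re = s.re - 1 := by simp
  rw [hre]
  rcases le_total 1 t with h | h
  · exact (Real.rpow_le_rpow_of_exponent_le h (by linarith)).trans
      (le_add_of_nonneg_left (by positivity))
  · exact (Real.rpow_le_rpow_of_exponent_ge ht0 h (by linarith)).trans
      (le_add_of_nonneg_right (by positivity))

/-- The function is a finite combination of Hurwitz zeta functions, which are Mellin transforms.
Their polar terms drop out because `χ 0 = 0` and `∑ χ j = 0`. -/
theorem boundedOnStrips_completedLFunction {q : ℕ} [NeZero q] (hq : q ≠ 1)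
    (χ : DirichletCharacter ℂ q) (hχ : χ ≠ 1) :
    BoundedOnStrips (DirichletCharacter.completedLFunction χ) := by
  have hE : ∀ a, BoundedOnStrips (HurwitzZeta.completedHurwitzZetaEven₀ a) := fun a => by
    have h := boundedOnStrips_mellin fun s =>
      ((HurwitzZeta.hurwitzEvenFEPair a).isStrongFEPair_toStrongFEPair.hasMellin s).1
    have h2 := (h.comp_add_div_two 0).const_mul (1 / 2)
    convert h2 using 2 with s
    rw [HurwitzZeta.completedHurwitzZetaEven₀, ofReal_zero, add_zero, one_div_mul_eq_div]
    rfl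
  have hO : ∀ a, BoundedOnStrips (HurwitzZeta.completedHurwitzZetaOdd a) := fun a => by
    have h := boundedOnStrips_mellin fun s =>
      ((HurwitzZeta.isStrong_hurwitzOddFEPair a).hasMellin s).1
    have h2 := (h.comp_add_div_two 1).const_mul (1 / 2)
    convert h2 using 2 with s
    rw [HurwitzZeta.completedHurwitzZetaOdd, (HurwitzZeta.isStrong_hurwitzOddFEPair a).Λ_eq,
      ofReal_one, one_div_mul_eq_div]
  have hN : BoundedOnStrips fun s => (q : ℂ) ^ (-s) := by
    simpa using boundedOnStrips_natCast_cpow (NeZero.pos q) (a := -1) (b := 0)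
  have h := (hN.mul (boundedOnStrips_sum Finset.univ
      fun j : ZMod q => (hE (ZMod.toAddCircle j)).const_mul (χ j))).add
    (hN.mul (boundedOnStrips_sum Finset.univ
      fun j : ZMod q => (hO (ZMod.toAddCircle j)).const_mul (χ j)))
  convert h using 2 with s
  rw [DirichletCharacter.completedLFunction, ZMod.completedLFunction_eq, χ.map_zero' hq,
    MulChar.sum_eq_zero_of_ne_one hχ, ZMod.completedLFunction₀]
  simp

theorem boundedOnStrips_xi {q : ℕ} [NeZero q] (hq : q ≠ 1)
    (χ : DirichletCharacter ℂ q) (hχ : χ ≠ 1) : BoundedOnStrips (xi χ) := by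
  have h := (boundedOnStrips_natCast_cpow (NeZero.pos q) (a := ((1 / 2 : ℝ) : ℂ))
    (b := kappa χ / 2)).mul (boundedOnStrips_completedLFunction hq χ hχ)
  convert h using 2 with s
  rw [xi, ofReal_re]
  congr 2
  push_cast
  ring

theorem kappa_inv {q : ℕ} (χ : DirichletCharacter ℂ q) : kappa χ⁻¹ = kappa χ := by
  have h : χ⁻¹ (-1) = 1 ↔ χ (-1) = 1 := by
    rw [MulChar.inv_apply_eq_inv', inv_eq_one]
  unfold kappa
  simp only [h]

theorem epsilon_eq_rootNumber {q : ℕ} [NeZero q] (χ : DirichletCharacter ℂ q) :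
    epsilon χ = DirichletCharacter.rootNumber χ := by
  have hsqrt : (Real.sqrt q : ℂ) = (q : ℂ) ^ (1 / 2 : ℂ) := by
    rw [Real.sqrt_eq_rpow, ofReal_cpow (Nat.cast_nonneg q)]
    simp
  have hk : DirichletCharacter.rootNumber χ =
      gaussSum χ ZMod.stdAddChar / I ^ kappa χ / (q : ℂ) ^ (1 / 2 : ℂ) := by
    unfold DirichletCharacter.rootNumber kappa
    congr
  rw [epsilon, hk, ← hsqrt, div_div, gaussSum]
  congr 1
  refine Finset.sum_congr rfl fun a _ => ?_
  rw [ZMod.stdAddChar_apply, ZMod.toCircle_apply]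

/-- The power of `q` in `xi` absorbs the factor `q ^ (1 / 2 - s)` in the equation for
`completedLFunction`. -/
theorem xi_functional_equation {q : ℕ} [NeZero q] {χ : DirichletCharacter ℂ q}
    (hχ : χ.IsPrimitive) (s : ℂ) : xi χ s = epsilon χ * xi χ⁻¹ (1 - s) := by
  have h := hχ.completedLFunction_one_sub (1 - s)
  rw [sub_sub_cancel] at h
  have hq : (q : ℂ) ≠ 0 := NeZero.ne _
  rw [xi, xi, h, kappa_inv, epsilon_eq_rootNumber, ← mul_assoc, ← mul_assoc, ← mul_assoc,
    ← cpow_add _ _ hq, mul_comm (DirichletCharacter.rootNumber χ)]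
  congr 3
  ring

/-! ### The splitting of `ξ` into two tails -/

theorem norm_natCast_chi_le {q : ℕ} (χ : DirichletCharacter ℂ q) (n : ℕ) :
    ‖χ (n : ZMod q)‖ ≤ 1 := χ.norm_le_one _

theorem chi_natCast_zero {q : ℕ} (hq : q ≠ 1) (χ : DirichletCharacter ℂ q) :
    χ ((0 : ℕ) : ZMod q) = 0 := by
  rw [Nat.cast_zero, χ.map_zero' hq]

/-- The part over `x > 1` of the Mellin integral that represents `ξ`. -/
noncomputable def fullTail {q : ℕ} (χ : DirichletCharacter ℂ q) : ℂ → ℂ :=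
  thetaTail (fun n => χ (n : ZMod q)) (kappa χ) (Real.pi / q)

theorem exists_xi_sub_fullTail_bound {q : ℕ} [NeZero q] (hq : q ≠ 1)
    (χ : DirichletCharacter ℂ q) : ∃ C : ℝ, ∀ s : ℂ, 2 ≤ s.re →
      ‖(s + kappa χ) / 2‖ * ‖xi χ s - fullTail χ s‖ ≤ C := by
  obtain ⟨C, hC⟩ := exists_completed_sub_thetaTail_bound (norm_natCast_chi_le χ)
    (chi_natCast_zero hq χ) (kappa χ) (pi_div_pos q)
  refine ⟨C, fun s hs => ?_⟩
  have h := hC s hs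
  have hne : ∀ m : ℕ, (s + kappa χ) / 2 ≠ -m := fun m he => by
    have := congrArg re he
    rw [div_ofNat_re, add_re, natCast_re, neg_re, natCast_re] at this
    have h1 : (0 : ℝ) ≤ kappa χ := Nat.cast_nonneg _
    have h2 : (0 : ℝ) ≤ m := Nat.cast_nonneg _
    linarith
  rwa [← g_eq, ← DirichletCharacter.LFunction_eq_LSeries χ (by linarith), ← xi_eq hq χ s hne] at h

theorem differentiable_fullTail {q : ℕ} [NeZero q] (hq : q ≠ 1) (χ : DirichletCharacter ℂ q) :
    Differentiable ℂ (fullTail χ) :=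
  differentiable_thetaTail (norm_natCast_chi_le χ) (chi_natCast_zero hq χ) _ (pi_div_pos q)

theorem exists_fullTail_bound {q : ℕ} [NeZero q] (hq : q ≠ 1) (χ : DirichletCharacter ℂ q)
    (σ : ℝ) : ∃ C : ℝ, ∀ s : ℂ, s.re ≤ σ →
      ‖fullTail χ s‖ ≤ C ∧ ‖(s + kappa χ) / 2‖ * ‖fullTail χ s‖ ≤ C :=
  exists_thetaTail_bound (norm_natCast_chi_le χ) (chi_natCast_zero hq χ) _ (pi_div_pos q) σ

theorem half_re_le_norm (k : ℕ) (s : ℂ) : s.re / 2 ≤ ‖(s + k) / 2‖ := by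
  refine le_trans ?_ (re_le_norm _)
  rw [div_ofNat_re, add_re, natCast_re]
  have : (0 : ℝ) ≤ k := Nat.cast_nonneg _
  linarith

/-- The two halves of the Mellin integral of the theta series give `ξ`. -/
theorem xi_eq_fullTail {q : ℕ} [NeZero q] (hq : q ≠ 1) {χ : DirichletCharacter ℂ q}
    (hχ : χ.IsPrimitive) (s : ℂ) :
    xi χ s = fullTail χ s + epsilon χ * fullTail χ⁻¹ (1 - s) := by
  have hχ1 : χ ≠ 1 := by
    rintro rfl
    have h : (1 : DirichletCharacter ℂ q).conductor = q := hχ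
    rw [DirichletCharacter.conductor_one] at h
    exact hq h.symm
  obtain ⟨C₁, h₁⟩ := exists_xi_sub_fullTail_bound hq χ
  obtain ⟨C₂, h₂⟩ := exists_xi_sub_fullTail_bound hq χ⁻¹
  obtain ⟨C₃, h₃⟩ := exists_fullTail_bound hq χ 2
  obtain ⟨C₄, h₄⟩ := exists_fullTail_bound hq χ⁻¹ 2
  obtain ⟨C₅, h₅⟩ := boundedOnStrips_xi hq χ hχ1 (-1) 2
  set F : ℂ → ℂ := fun s => xi χ s - fullTail χ s - epsilon χ * fullTail χ⁻¹ (1 - s) with hF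
  have hre : ∀ z : ℂ, (1 - z).re = 1 - z.re := fun z => by simp
  have hdiv : ∀ (k : ℕ) (z w : ℂ) (C : ℝ), 2 ≤ z.re → ‖(z + k) / 2‖ * ‖w‖ ≤ C → ‖w‖ ≤ C := by
    intro k z w C hz h
    have := half_re_le_norm k z
    nlinarith [norm_nonneg w]
  -- To the right of `2` the Dirichlet series gives the bound, to the left of `-1` the functional
  -- equation transfers it to `χ⁻¹`, and in between `ξ` is bounded on the strip.
  have hbd : ∀ z, ‖F z‖ ≤ max (C₁ + ‖epsilon χ‖ * C₄)
      (max (‖epsilon χ‖ * C₂ + C₃) (C₅ + C₃ + ‖epsilon χ‖ * C₄)) := by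
    intro z
    rcases le_total 2 z.re with hz | hz
    · refine le_trans ?_ (le_max_left _ _)
      refine (norm_sub_le _ _).trans (add_le_add (hdiv _ z _ _ hz (h₁ z hz)) ?_)
      rw [norm_mul]
      exact mul_le_mul_of_nonneg_left (h₄ _ (by rw [hre]; linarith)).1 (norm_nonneg _)
    · refine le_trans ?_ (le_max_right _ _)
      rcases le_total z.re (-1) with hz' | hz'
      · refine le_trans ?_ (le_max_left _ _)
        have e : F z = epsilon χ * (xi χ⁻¹ (1 - z) - fullTail χ⁻¹ (1 - z)) - fullTail χ z := by
          simp only [hF]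
          rw [xi_functional_equation hχ z]
          ring
        have hz2 : 2 ≤ (1 - z).re := by rw [hre]; linarith
        rw [e]
        refine (norm_sub_le _ _).trans (add_le_add ?_ (h₃ z hz).1)
        rw [norm_mul]
        exact mul_le_mul_of_nonneg_left (hdiv _ _ _ _ hz2 (h₂ _ hz2)) (norm_nonneg _)
      · refine le_trans ?_ (le_max_right _ _)
        refine (norm_sub_le _ _).trans (add_le_add ((norm_sub_le _ _).trans
          (add_le_add (h₅ z hz' hz) (h₃ z hz).1)) ?_)
        rw [norm_mul]
        exact mul_le_mul_of_nonneg_left (h₄ _ (by rw [hre]; linarith)).1 (norm_nonneg _)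
  have hFd : Differentiable ℂ F :=
    ((differentiable_xi χ hχ1).sub (differentiable_fullTail hq χ)).sub
      (((differentiable_fullTail hq χ⁻¹).comp (differentiable_id.const_sub 1)).const_mul _)
  -- Liouville's theorem; the constant is then found to be `0` along the positive integers.
  have hconst : ∀ z, F z = F s := fun z => hFd.apply_eq_apply_of_bounded
    (isBounded_iff_forall_norm_le.2 ⟨_, by rintro _ ⟨z, rfl⟩; exact hbd z⟩) z s
  have hzero : Tendsto (fun n : ℕ => F n) atTop (𝓝 0) := by
    refine squeeze_zero_norm' (a := fun n : ℕ => 2 * C₁ / n + ‖epsilon χ‖ * (4 * C₄ / n)) ?_ ?_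
    · filter_upwards [eventually_ge_atTop 2] with n hn
      have hn' : (2 : ℝ) ≤ n := by exact_mod_cast hn
      have hn0 : (0 : ℝ) < n := by linarith
      have hnr : (n : ℂ).re = n := natCast_re n
      refine (norm_sub_le _ _).trans (add_le_add ?_ ?_)
      · rw [le_div_iff₀ hn0]
        have h := h₁ n (by rwa [hnr])
        have h' := half_re_le_norm (kappa χ) n
        rw [hnr] at h'
        nlinarith [norm_nonneg (xi χ n - fullTail χ n)]
      · rw [norm_mul]
        refine mul_le_mul_of_nonneg_left ?_ (norm_nonneg _)
        rw [le_div_iff₀ hn0]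
        have h := h₄ (1 - n) (by rw [hre, hnr]; linarith)
        -- The constant `4 * C₄` is `2 * C₄` from this decay factor plus `2 * C₄` from the plain
        -- bound, since `n = (n - 2) + 2`.
        have h' : ((n : ℝ) - 2) / 2 ≤ ‖((1 - n : ℂ) + kappa χ⁻¹) / 2‖ := by
          refine le_trans ?_ (abs_re_le_norm _)
          rw [div_ofNat_re, add_re, hre, hnr, natCast_re]
          have hk : (kappa χ⁻¹ : ℝ) ≤ 1 := by
            unfold kappa
            split_ifs <;> simp
          refine le_trans ?_ (neg_le_abs _)
          linarith
        nlinarith [norm_nonneg (fullTail χ⁻¹ (1 - n))]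
    · have hc : ∀ c : ℝ, Tendsto (fun n : ℕ => c / n) atTop (𝓝 0) :=
        fun c => tendsto_const_div_atTop_nhds_zero_nat c
      simpa using (hc _).add ((hc _).const_mul _)
  have h0 : F s = 0 := tendsto_nhds_unique (tendsto_const_nhds.congr fun n : ℕ => (hconst n).symm)
    hzero
  simp only [hF] at h0
  linear_combination h0

/-! ### The terms `J(n)` and the error formula -/

/-- The substitution `t = a * x`. -/
theorem incGamma_eq {a : ℝ} (ha : 0 < a) (z : ℂ) :
    incGamma z a = (a : ℂ) ^ z * expTail z a := by
  have hac : (a : ℂ) ≠ 0 := by exact_mod_cast ha.ne'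
  have h := integral_comp_mul_left_Ioi
    (fun t : ℝ => (Real.exp (-t) : ℂ) * (t : ℂ) ^ (z - 1)) 1 ha
  rw [mul_one, real_smul, ofReal_inv] at h
  have h2 : incGamma z a = a * ∫ x in Ioi (1 : ℝ),
      ((Real.exp (-(a * x)) : ℝ) : ℂ) * ((a * x : ℝ) : ℂ) ^ (z - 1) := by
    rw [h, mul_inv_cancel_left₀ hac]
    rfl
  rw [h2, expTail_eq, ← integral_const_mul, ← integral_const_mul]
  refine setIntegral_congr_fun measurableSet_Ioi fun x hx => ?_
  have hx0 : (0 : ℝ) ≤ x := (zero_lt_one.trans hx).le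
  rw [ofReal_mul, mul_cpow_ofReal_nonneg ha.le hx0, cpow_sub _ _ hac, cpow_one]
  field_simp

theorem inv_cpow_mul_incGamma {a b : ℝ} (ha : 0 < a) (hab : b * a = 1) (z : ℂ) :
    (b : ℂ) ^ z * incGamma z a = expTail z a := by
  have hb : 0 ≤ b := (pos_of_mul_pos_left (hab ▸ one_pos) ha.le).le
  rw [incGamma_eq ha, ← mul_assoc, ← mul_cpow_ofReal_nonneg hb ha.le, ← ofReal_mul, hab]
  simp

theorem J_eq {q : ℕ} [NeZero q] (χ : DirichletCharacter ℂ q) (s : ℂ) {n : ℕ} (hn : n ≠ 0) :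
    J χ s n =
      χ (n : ZMod q) * (n : ℂ) ^ kappa χ * expTail ((s + kappa χ) / 2) (Real.pi / q * n ^ 2) +
      epsilon χ * (χ⁻¹ (n : ZMod q) * (n : ℂ) ^ kappa χ⁻¹ *
        expTail ((1 - s + kappa χ⁻¹) / 2) (Real.pi / q * n ^ 2)) := by
  have hq : (0 : ℝ) < q := by exact_mod_cast NeZero.pos q
  have hn' : (0 : ℝ) < n := by exact_mod_cast Nat.pos_of_ne_zero hn
  have hpi := Real.pi_pos
  have key := inv_cpow_mul_incGamma (a := n ^ 2 * Real.pi / q) (b := q / (n ^ 2 * Real.pi))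
    (by positivity) (by field_simp)
  have hconj : (starRingEnd ℂ) (χ (n : ZMod q)) = χ⁻¹ (n : ZMod q) := MulChar.star_apply' χ _
  rw [J, mul_assoc _ _ (incGamma _ _), mul_assoc _ _ (incGamma _ _), key, key, hconj, kappa_inv,
    show (n : ℝ) ^ 2 * Real.pi / q = Real.pi / q * n ^ 2 by ring, add_comm (kappa χ : ℂ) s,
    show (kappa χ : ℂ) + 1 - s = 1 - s + kappa χ by ring]
  ring

/-- For a prime `p`, `u < p` is the same as `⌊u⌋₊ + 1 ≤ p`; this also holds for negative `u`, since
`p ≠ 0`. -/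
theorem mem_A_iff {u : ℝ} {n : ℕ} : n ∈ A u ↔ n ≠ 0 ∧ n ∉ Nat.smoothNumbers (⌊u⌋₊ + 1) := by
  rw [Nat.mem_smoothNumbers']
  simp only [A, mem_ofPred_eq, Nat.pos_iff_ne_zero]
  refine and_congr_right fun hn => ?_
  push Not
  refine exists_congr fun p => and_congr_right fun hp => and_congr_right fun _ => ?_
  rw [Nat.add_one_le_iff, Nat.floor_lt' hp.ne_zero]

/-- The difference of the two tails is the sum over the integers that are not smooth. -/
theorem hasSum_fullTail_sub_smoothTail {q : ℕ} [NeZero q] (hq : q ≠ 1) (χ : DirichletCharacter ℂ q)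
    (u : ℝ) (s : ℂ) :
    HasSum ((A u).indicator fun n : ℕ => χ (n : ZMod q) * (n : ℂ) ^ kappa χ *
      expTail ((s + kappa χ) / 2) (Real.pi / q * n ^ 2)) (fullTail χ s - smoothTail χ u s) := by
  have h1 := (summable_thetaTail (norm_natCast_chi_le χ) (chi_natCast_zero hq χ) (kappa χ)
    (pi_div_pos q) s).hasSum
  have h2 := (summable_thetaTail (norm_smoothCoeff_le χ u) (smoothCoeff_zero χ u) (kappa χ)
    (pi_div_pos q) s).hasSum
  refine (h1.sub h2).congr_fun fun n => ?_
  by_cases hn : n ∈ Nat.smoothNumbers (⌊u⌋₊ + 1)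
  · rw [indicator_of_notMem fun h => (mem_A_iff.1 h).2 hn, smoothCoeff, indicator_of_mem hn,
      sub_self]
  · rw [smoothCoeff, indicator_of_notMem hn]
    rcases eq_or_ne n 0 with rfl | hn0
    · rw [indicator_of_notMem fun h => (mem_A_iff.1 h).1 rfl, chi_natCast_zero hq]
      simp
    · rw [indicator_of_mem (mem_A_iff.2 ⟨hn0, hn⟩)]
      simp

/-- Both `ξ` and `ξ_u^≈` are a tail at `s` plus `ε` times a tail at `1 - s`, so the difference is
taken term by term. In `ℂ`, `HasSum` already includes absolute convergence. -/
theorem hasSum_J {q : ℕ} [NeZero q] (hq : q ≠ 1) {χ : DirichletCharacter ℂ q}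
    (hχ : χ.IsPrimitive) (u : ℝ) (s : ℂ) :
    HasSum (fun n : A u => J χ s n) (xi χ s - xiApprox χ u s) := by
  have h := (hasSum_fullTail_sub_smoothTail hq χ u s).add
    ((hasSum_fullTail_sub_smoothTail hq χ⁻¹ u (1 - s)).mul_left (epsilon χ))
  have e : xi χ s - xiApprox χ u s = (fullTail χ s - smoothTail χ u s) +
      epsilon χ * (fullTail χ⁻¹ (1 - s) - smoothTail χ⁻¹ u (1 - s)) := by
    rw [xi_eq_fullTail hq hχ s, xiApprox, xiReg_eq, xiReg_eq]
    ring
  rw [e]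
  refine (hasSum_subtype_iff_indicator (f := J χ s)).2 (h.congr_fun fun n => ?_)
  by_cases hn : n ∈ A u
  · rw [indicator_of_mem hn, indicator_of_mem hn, indicator_of_mem hn,
      J_eq χ s (mem_A_iff.1 hn).1]
  · simp [indicator_of_notMem hn]

end DirichletApprox

open DirichletApprox in
theorem theorem1 {q : ℕ} [NeZero q] (hq : 1 < q) (χ : DirichletCharacter ℂ q)
    (hχ : χ.IsPrimitive) (u : ℝ) (s₀ : ℂ) :
    -- the sum over the poles that defines the principal part converges
    (∀ s : ℂ, (∀ p ∈ goodPrimes q u, ∀ h : ℤ, s ≠ eulerPole χ p h) →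
      Tendsto (fun T => eulerPartTrunc χ u T s) (separatedRadii χ u) (𝓝 (eulerPart χ u s))) ∧
    -- the regular part is the entire extension of `ξ_u - ξ_u^pp`
    (Differentiable ℂ (xiReg χ u) ∧
      ∀ s : ℂ, Tendsto (fun z => xiU χ u z - xiPP χ u z) (𝓝[≠] s) (𝓝 (xiReg χ u s))) ∧
    -- the formula for the error
    HasSum (fun n : A u => J χ s₀ n) (xi χ s₀ - xiApprox χ u s₀) := by
  rw [xiReg_eq χ u]
  exact ⟨fun s hs => tendsto_eulerPart χ hs,
    ⟨differentiable_smoothTail χ u, tendsto_xiU_sub_xiPP χ u⟩, hasSum_J hq.ne' hχ u s₀⟩
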